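/- All manifolds are smooth, finite-dimensional and without boundary, and all metrics are smooth pseudo-Riemannian metrics of arbitrary signature. A metric $g$ is \emph{$k$-universal} if every symmetric rank-2 tensor $T_{ab}$ that is conserved ($\nabla^a T_{ab}=0$) and is a contraction of a polynomial (with real coefficients) in the metric, the Riemann tensor and its covariant derivatives up to order $k$ is a constant multiple of $g$; it is \emph{universal} if it is $k$-universal for all $k$. A \emph{maximally symmetric space} of dimension $m$ is one of constant curvature, i.e. $R_{abcd}=K(g_{ac}g_{bd}-g_{ad}g_{bc})$ with a constant $K$ (so that its Ricci scalar is $m(m-1)K$); it is \emph{non-flat} if its Riemann tensor does not vanish identically. (1) Let $N\ge 1$ and let $(M_\alpha,g_\alpha)$, $\alpha=0,\dots,N-1$, be non-flat maximally symmetric spaces of dimensions $n_\alpha$ with Ricci scalars $R_\alpha$. Then the direct product $M=M_0\times M_1\times\dots\times M_{N-1}$, with the product metric, is universal if and only if $n_\alpha=n_0$ and $R_\alpha=R_0$ for all $\alpha$. (2) For every composite number $d\ge 4$ there is a $d$-dimensional universal Lorentzian manifold (Hausdorff, second countable and connected) which is of Weyl type D at every point, and it can be taken to be a direct product of at least two non-flat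 maximally symmetric spaces. Here the Weyl tensor $C$ is of type D at a point if $C\neq 0$ there and there are null vectors $\ell,n$ with $g(\ell,n)=1$ such that all components of $C$ of non-zero boost weight in the null frames $(\ell,n,m_i)$ vanish. -/

import Mathlib

open scoped Manifold ContDiff

noncomputable section

namespace PseudoRiem

/-! ### Metrics and covariant tensor fields

Manifolds are boundaryless and are modelled directly on a finite-dimensional real normed space `E`.
The tangent space at `p` is Mathlib's `TangentSpace 𝓘(ℝ, E) p`, which is by definition `E` itself,
identified with `T_p M` through the preferred chart `chartAt E p`; below it is written as `E`. -/

section Basic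

variable (E : Type*) [NormedAddCommGroup E] [NormedSpace ℝ E]
  (M : Type*) [TopologicalSpace M] [ChartedSpace E M]

/-- A field of bilinear forms on the tangent spaces of `M`. -/
abbrev MetricField : Type _ :=
  M → E →L[ℝ] E →L[ℝ] ℝ

/-- A field of real functions of `r` tangent vectors, used for covariant tensors of rank `r`. -/
abbrev TensorField (r : ℕ) : Type _ :=
  M → (Fin r → E) → ℝ

end Basic

section Coordinates

variable {E : Type*} [NormedAddCommGroup E] [NormedSpace ℝ E]
  {M : Type*} [TopologicalSpace M] [ChartedSpace E M]

/-- The differential at `y` of the inverse of the preferred chart around `x`, which maps coordinate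
vectors in that chart to the tangent space (`= E`) at the point with coordinates `y`. -/
def chartPush (M : Type*) [TopologicalSpace M] [ChartedSpace E M] (x : M) (y : E) : E →L[ℝ] E :=
  mfderiv 𝓘(ℝ, E) 𝓘(ℝ, E) (chartAt E x).symm y

/-- The expression of the tensor field `T` in the coordinates of the preferred chart around `x`,
at the coordinate point `y`. -/
def TensorField.inChart {r : ℕ} (T : TensorField E M r) (x : M) (y : E) (v : Fin r → E) : ℝ :=
  T ((chartAt E x).symm y) (fun i => chartPush M x y (v i))

/-- The metric as a tensor field of rank two. -/
def metricTensor (g : MetricField E M) : TensorField E M 2 :=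
  fun p v => g p (v 0) (v 1)

/-- The coordinate expression `g_{ab}(y)` of the metric in the preferred chart around `x`. -/
def metricInChart (g : MetricField E M) (x : M) (y : E) (v w : E) : ℝ :=
  TensorField.inChart (metricTensor g) x y ![v, w]

/-- `g` is a smooth pseudo-Riemannian metric (of arbitrary signature). -/
structure IsPseudoRiemannian (g : MetricField E M) : Prop where
  symm : ∀ (p : M) (v w : E), g p v w = g p w v
  nondegenerate : ∀ (p : M) (v : E), (∀ w, g p v w = 0) → v = 0
  smooth : ∀ (x : M) (v w : E),
    ContDiffOn ℝ ∞ (fun y => metricInChart g x y v w) (chartAt E x).target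

/-- `g` has signature `(-, +, …, +)` at every point: there is a timelike vector on whose
orthogonal complement `g` is positive definite. -/
def IsLorentzian (g : MetricField E M) : Prop :=
  ∀ p : M, ∃ u : E, g p u u < 0 ∧
    ∀ v : E, g p u v = 0 → v ≠ 0 → 0 < g p v v

variable [FiniteDimensional ℝ E]

/-- An auxiliary basis of `E`, used to write out contractions; no notion below depends on it. -/
def frame (E : Type*) [NormedAddCommGroup E] [NormedSpace ℝ E] [FiniteDimensional ℝ E] :
    Module.Basis (Fin (Module.finrank ℝ E)) ℝ E :=
  Module.finBasis ℝ E

/-- The components `b^{ij}` of the inverse of a bilinear form `b` in the auxiliary basis. -/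
def inverseForm (b : E → E → ℝ) (i j : Fin (Module.finrank ℝ E)) : ℝ :=
  (Matrix.of fun k l => b (frame E k) (frame E l))⁻¹ i j

/-- The components `g^{ij}` of the inverse metric at `p`. -/
def inverseMetric (g : MetricField E M) (p : M) (i j : Fin (Module.finrank ℝ E)) : ℝ :=
  inverseForm (fun v w => g p v w) i j

/-- Christoffel symbols of the first kind in the preferred chart around `x`:
`Γ(u, v; w) = (∂_u g(v, w) + ∂_v g(u, w) - ∂_w g(u, v)) / 2` for constant `u, v, w`. -/
def christoffelFirst (g : MetricField E M) (x : M) (y u v w : E) : ℝ :=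
  (1 / 2 : ℝ) *
    (fderiv ℝ (fun z => metricInChart g x z v w) y u
      + fderiv ℝ (fun z => metricInChart g x z u w) y v
      - fderiv ℝ (fun z => metricInChart g x z u v) y w)

/-- Christoffel symbols of the second kind, `Γ(u, v) ∈ E`, of the Levi-Civita connection
in the preferred chart around `x`. -/
def christoffel (g : MetricField E M) (x : M) (y u v : E) : E :=
  ∑ i, ∑ j, (inverseForm (fun a b => metricInChart g x y a b) i j
    * christoffelFirst g x y u v (frame E i)) • frame E j

/-- The curvature operator `R(u, v) w = ∇_u ∇_v w - ∇_v ∇_u w - ∇_{[u, v]} w` at `p`. -/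
def curvature (g : MetricField E M) (p : M) (u v w : E) : E :=
  let y : E := chartAt E p p
  fderiv ℝ (fun z => christoffel g p z v w) y u
    - fderiv ℝ (fun z => christoffel g p z u w) y v
    + christoffel g p y u (christoffel g p y v w)
    - christoffel g p y v (christoffel g p y u w)

/-- The Riemann tensor `R_{abcd}`, with the convention that
`R_{abcd} = K (g_{ac} g_{bd} - g_{ad} g_{bc})` for constant curvature `K`. -/
def riemann (g : MetricField E M) : TensorField E M 4 :=
  fun p v => g p (curvature g p (v 0) (v 1) (v 3)) (v 2)

/-- The Ricci tensor `R_{bd} = g^{ac} R_{abcd}`. -/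
def ricci (g : MetricField E M) : TensorField E M 2 :=
  fun p v => ∑ i, ∑ j, inverseMetric g p i j *
    riemann g p ![frame E i, v 0, frame E j, v 1]

/-- The Ricci scalar `R = g^{bd} R_{bd}`. -/
def ricciScalar (g : MetricField E M) (p : M) : ℝ :=
  ∑ i, ∑ j, inverseMetric g p i j * ricci g p ![frame E i, frame E j]

/-- The Levi-Civita covariant derivative of a covariant tensor field;
the new index (the direction of differentiation) comes first. -/
def covDeriv (g : MetricField E M) {r : ℕ} (T : TensorField E M r) : TensorField E M (r + 1) :=
  fun p v =>
    let y : E := chartAt E p p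
    let u : E := v 0
    let w : Fin r → E := fun i => v i.succ
    fderiv ℝ (fun z => T.inChart p z w) y u
      - ∑ i, T p (Function.update w i (christoffel g p y u (w i)))

/-- The `k`-th covariant derivative of the Riemann tensor. -/
def nablaRiemann (g : MetricField E M) : (k : ℕ) → TensorField E M (4 + k)
  | 0 => riemann g
  | k + 1 => covDeriv g (nablaRiemann g k)

/-- Contraction of the first two indices with the inverse metric. -/
def contract (g : MetricField E M) {r : ℕ} (T : TensorField E M (r + 2)) : TensorField E M r :=
  fun p v => ∑ i, ∑ j, inverseMetric g p i j *
    T p (Matrix.vecCons (frame E i) (Matrix.vecCons (frame E j) v))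

/-- The tensors of rank `r` that are contractions of polynomials in the metric, the Riemann tensor
and its covariant derivatives up to order `k`. -/
inductive IsCurvaturePolynomial (g : MetricField E M) (k : ℕ) :
    (r : ℕ) → TensorField E M r → Prop
  | metric : IsCurvaturePolynomial g k 2 (metricTensor g)
  | nablaRiemann (j : ℕ) (hj : j ≤ k) : IsCurvaturePolynomial g k (4 + j) (nablaRiemann g j)
  | add {r : ℕ} {S T : TensorField E M r} (hS : IsCurvaturePolynomial g k r S)
      (hT : IsCurvaturePolynomial g k r T) :
      IsCurvaturePolynomial g k r (fun p v => S p v + T p v)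
  | smul {r : ℕ} (c : ℝ) {T : TensorField E M r} (hT : IsCurvaturePolynomial g k r T) :
      IsCurvaturePolynomial g k r (fun p v => c * T p v)
  | tensor {r s : ℕ} {S : TensorField E M r} {T : TensorField E M s}
      (hS : IsCurvaturePolynomial g k r S) (hT : IsCurvaturePolynomial g k s T) :
      IsCurvaturePolynomial g k (r + s)
        (fun p v => S p (fun i => v (Fin.castAdd s i)) * T p (fun i => v (Fin.natAdd r i)))
  | perm {r : ℕ} (σ : Equiv.Perm (Fin r)) {T : TensorField E M r}
      (hT : IsCurvaturePolynomial g k r T) :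
      IsCurvaturePolynomial g k r (fun p v => T p (fun i => v (σ i)))
  | contract {r : ℕ} {T : TensorField E M (r + 2)}
      (hT : IsCurvaturePolynomial g k (r + 2) T) :
      IsCurvaturePolynomial g k r (contract g T)

/-- A rank-two tensor field is symmetric. -/
def IsSymmetric (T : TensorField E M 2) : Prop :=
  ∀ (p : M) (v w : E), T p ![v, w] = T p ![w, v]

/-- A rank-two tensor field is conserved: `∇^a T_{ab} = 0`. -/
def IsConserved (g : MetricField E M) (T : TensorField E M 2) : Prop :=
  ∀ (p : M) (v : Fin 1 → E), contract g (covDeriv g T) p v = 0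

/-- All conserved symmetric rank-two tensors constructed from the metric, the Riemann tensor and
its covariant derivatives up to order `k` are constant multiples of the metric. -/
def IsKUniversal (g : MetricField E M) (k : ℕ) : Prop :=
  ∀ T : TensorField E M 2, IsCurvaturePolynomial g k 2 T → IsSymmetric T → IsConserved g T →
    ∃ c : ℝ, ∀ (p : M) (v w : E), T p ![v, w] = c * g p v w

/-- The metric is `k`-universal for all `k`. -/
def IsUniversal (g : MetricField E M) : Prop :=
  ∀ k : ℕ, IsKUniversal g k

/-- Maximally symmetric: the Riemann tensor is `R_{abcd} = K (g_{ac} g_{bd} - g_{ad} g_{bc})`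
with a constant `K`. -/
def IsMaximallySymmetric (g : MetricField E M) : Prop :=
  ∃ K : ℝ, ∀ (p : M) (a b c d : E),
    riemann g p ![a, b, c, d] = K * (g p a c * g p b d - g p a d * g p b c)

/-- Flat: the Riemann tensor vanishes identically. -/
def IsFlat (g : MetricField E M) : Prop :=
  ∀ (p : M) (v : Fin 4 → E), riemann g p v = 0

/-- The Weyl tensor `C_{abcd}` (meaningful in dimension at least three). -/
def weyl (g : MetricField E M) (p : M) (a b c d : E) : ℝ :=
  let n : ℝ := Module.finrank ℝ E
  riemann g p ![a, b, c, d]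
    - 1 / (n - 2) *
      (g p a c * ricci g p ![b, d] - g p a d * ricci g p ![b, c]
        - g p b c * ricci g p ![a, d] + g p b d * ricci g p ![a, c])
    + ricciScalar g p / ((n - 1) * (n - 2)) * (g p a c * g p b d - g p a d * g p b c)

/-- All components of the Weyl tensor at `p` of positive boost weight vanish in the null frames
`l, n, m_i`: those are `C(l, m_i, l, m_j)` of weight 2, and
`C(l, n, l, m_i)`, `C(l, m_i, m_j, m_k)` of weight 1. -/
def PositiveBoostWeightVanish (g : MetricField E M) (p : M)
    (l n : E) : Prop :=
  ∀ x y z : E,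
    g p l x = 0 → g p n x = 0 → g p l y = 0 → g p n y = 0 → g p l z = 0 → g p n z = 0 →
      weyl g p l x l y = 0 ∧ weyl g p l n l x = 0 ∧ weyl g p l x y z = 0

/-- Weyl type D at every point: the Weyl tensor is nonzero, and in a suitable null frame
`l, n, m_i` only its components of boost weight zero are nonzero. -/
def IsWeylTypeD (g : MetricField E M) : Prop :=
  ∀ p : M, (∃ a b c d : E, weyl g p a b c d ≠ 0) ∧
    ∃ l n : E, g p l l = 0 ∧ g p n n = 0 ∧ g p l n = 1 ∧
      PositiveBoostWeightVanish g p l n ∧ PositiveBoostWeightVanish g p n l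

end Coordinates

section Product

variable {ι : Type*} [Fintype ι] {E : ι → Type*} [∀ α, NormedAddCommGroup (E α)]
  [∀ α, NormedSpace ℝ (E α)] {M : ι → Type*} [∀ α, TopologicalSpace (M α)]
  [∀ α, ChartedSpace (E α) (M α)]

/-- The product charts on a finite product of manifolds. -/
instance productChartedSpace : ChartedSpace (∀ α, E α) (∀ α, M α) :=
  piChartedSpace E M

/-- The direct product metric `g(v, w) = ∑ α, g_α(v_α, w_α)`. -/
def productMetric (g : ∀ α, MetricField (E α) (M α)) : MetricField (∀ α, E α) (∀ α, M α) :=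
  fun p => ∑ α, (g α (p α)).bilinearComp
    (ContinuousLinearMap.proj (R := ℝ) (φ := E) α) (ContinuousLinearMap.proj (R := ℝ) (φ := E) α)

end Product

end PseudoRiem

end

/-! A product of spaces of constant curvature has block diagonal geometry: the Levi-Civita
connection acts factor by factor, every block metric `g α` is parallel on the product, and the
Riemann tensor is the sum over the blocks of `K α` times the constant curvature expression in `g α`.
Hence all covariant derivatives of the Riemann tensor vanish.

For equal dimensions and curvatures, choose in each factor a complex orthonormal coframe; complex
square roots absorb the signature. In the resulting coframe of the product, the components of the
metric and of the Riemann tensor are the same at all points and are unchanged by sign flips of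
single coframe elements, by permutations of the blocks and by a common permutation inside the
blocks. Sums, tensor products, index permutations and contractions preserve this
(`IsCurvaturePolynomial.hasInvariantComponents`). In rank two, sign flips kill the off-diagonal
components, and the permutations act transitively on the diagonal, so only constant multiples of the
metric remain (`HasInvariantComponents.eq_const_mul`).

Conversely, the Ricci tensor and `R_{acde} R_b^{cde}` are sums of parallel block metrics, hence
conserved, with coefficients `(n α - 1) K α` and `2 (n α - 1) K α ^ 2`. Universality makes both
independent of `α`. Non-flatness gives `n α ≥ 2` and `K α ≠ 0`, so the two equations force equal `K
α` and then equal `n α`.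

For composite `d`, write `d` as a product of two factors that are at least 2 and multiply copies of
the metric `dt² + exp (2 t) h` of curvature `-1`, one of them Lorentzian. The product is Einstein,
and a null pair tangent to the Lorentzian block shows that its Weyl tensor is of type D. -/

noncomputable section

namespace PseudoRiem

/-! ### Coordinate changes and the Levi-Civita connection in a chart. -/

section Chart

variable {E : Type*} [NormedAddCommGroup E] [NormedSpace ℝ E]
  {M : Type*} [TopologicalSpace M] [ChartedSpace E M]

/-- `mfderiv` reads the target in the preferred chart of the image point, so `chartPush` is the
ordinary derivative of a transition map. -/
theorem hasFDerivAt_chartPush [IsManifold 𝓘(ℝ, E) ∞ M] (x : M) {y : E}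
    (hy : y ∈ (chartAt E x).target) :
    HasFDerivAt (fun z => chartAt E ((chartAt E x).symm y) ((chartAt E x).symm z))
      (chartPush M x y) y := by
  have h : MDifferentiableAt 𝓘(ℝ, E) 𝓘(ℝ, E) (chartAt E x).symm y :=
    (mdifferentiable_chart (I := 𝓘(ℝ, E)) x).mdifferentiableAt_symm hy
  have h2 : HasFDerivWithinAt
      (fun z => chartAt E ((chartAt E x).symm y) ((chartAt E x).symm z))
      (chartPush M x y) (Set.range id) y := h.hasMFDerivAt.2
  rwa [Set.range_id, hasFDerivWithinAt_univ] at h2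

theorem isInvertible_chartPush [IsManifold 𝓘(ℝ, E) ∞ M] (x : M) {y : E}
    (hy : y ∈ (chartAt E x).target) : (chartPush M x y).IsInvertible := by
  have : IsManifold 𝓘(ℝ, E) 1 M := IsManifold.of_le (n := ∞) (by simp)
  have h := isInvertible_mfderivWithin_extChartAt_symm (I := 𝓘(ℝ, E)) (x := x) (y := y)
    (by simpa using hy)
  rw [modelWithCornersSelf_coe, Set.range_id, mfderivWithin_univ] at h
  exact h

theorem chartPush_self [IsManifold 𝓘(ℝ, E) ∞ M] (p : M) :
    chartPush M p (chartAt E p p) = ContinuousLinearMap.id ℝ E := by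
  have hy := mem_chart_target E p
  have h := hasFDerivAt_chartPush p hy
  rw [(chartAt E p).left_inv (mem_chart_source E p)] at h
  refine h.unique ((hasFDerivAt_id _).congr_of_eventuallyEq ?_)
  filter_upwards [(chartAt E p).open_target.mem_nhds hy] with z hz
  exact (chartAt E p).right_inv hz

theorem TensorField.inChart_self [IsManifold 𝓘(ℝ, E) ∞ M] {r : ℕ} (T : TensorField E M r)
    (p : M) (v : Fin r → E) : T.inChart p (chartAt E p p) v = T p v := by
  simp [TensorField.inChart, chartPush_self]

/-- The coordinate expression of the metric as a bilinear form. -/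
def chartForm (g : MetricField E M) (x : M) (y : E) : E →L[ℝ] E →L[ℝ] ℝ :=
  (g ((chartAt E x).symm y)).bilinearComp (chartPush M x y) (chartPush M x y)

theorem metricInChart_eq (g : MetricField E M) (x : M) (y v w : E) :
    metricInChart g x y v w = chartForm g x y v w := by
  simp [metricInChart, TensorField.inChart, metricTensor, chartForm]

theorem metricInChart_self [IsManifold 𝓘(ℝ, E) ∞ M] (g : MetricField E M) (p : M) (v w : E) :
    metricInChart g p (chartAt E p p) v w = g p v w := by
  simp [metricInChart, TensorField.inChart_self, metricTensor]

theorem IsPseudoRiemannian.metricInChart_symm {g : MetricField E M} (hg : IsPseudoRiemannian g)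
    (x : M) (y v w : E) : metricInChart g x y v w = metricInChart g x y w v := by
  simp [metricInChart_eq, chartForm, hg.symm _ (chartPush M x y v)]

theorem IsPseudoRiemannian.metricInChart_nondegenerate [IsManifold 𝓘(ℝ, E) ∞ M]
    {g : MetricField E M} (hg : IsPseudoRiemannian g) (x : M) {y : E}
    (hy : y ∈ (chartAt E x).target) {v : E} (hv : ∀ w, metricInChart g x y v w = 0) : v = 0 := by
  obtain ⟨e, he⟩ := isInvertible_chartPush x hy
  have h : chartPush M x y v = 0 := by
    refine hg.nondegenerate ((chartAt E x).symm y) _ fun w => ?_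
    have := hv (e.symm w)
    rw [metricInChart_eq] at this
    simpa [chartForm, ← he] using this
  rw [← he] at h
  simpa using h

theorem IsPseudoRiemannian.metricInChart_ext [IsManifold 𝓘(ℝ, E) ∞ M]
    {g : MetricField E M} (hg : IsPseudoRiemannian g) (x : M) {y : E}
    (hy : y ∈ (chartAt E x).target) {v v' : E}
    (h : ∀ w, metricInChart g x y v w = metricInChart g x y v' w) : v = v' := by
  refine sub_eq_zero.1 (hg.metricInChart_nondegenerate x hy fun w => ?_)
  have := h w
  simp only [metricInChart_eq] at this ⊢
  simp [this]

theorem IsPseudoRiemannian.contDiffAt {g : MetricField E M} (hg : IsPseudoRiemannian g) (x : M)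
    {y : E} (hy : y ∈ (chartAt E x).target) (v w : E) :
    ContDiffAt ℝ ∞ (fun z => metricInChart g x z v w) y :=
  (hg.smooth x v w).contDiffAt ((chartAt E x).open_target.mem_nhds hy)

theorem IsPseudoRiemannian.differentiableAt {g : MetricField E M} (hg : IsPseudoRiemannian g)
    (x : M) {y : E} (hy : y ∈ (chartAt E x).target) (v w : E) :
    DifferentiableAt ℝ (fun z => metricInChart g x z v w) y :=
  (hg.contDiffAt x hy v w).differentiableAt (by simp)

theorem IsPseudoRiemannian.differentiableAt_christoffelFirst {g : MetricField E M}
    (hg : IsPseudoRiemannian g) (x : M) {y : E} (hy : y ∈ (chartAt E x).target) (u v w : E) :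
    DifferentiableAt ℝ (fun z => christoffelFirst g x z u v w) y := by
  have h : ∀ a b c, DifferentiableAt ℝ
      (fun z => fderiv ℝ (fun z' => metricInChart g x z' a b) z c) y := fun a b c =>
    (((hg.contDiffAt x hy a b).fderiv_right (m := 1) (by norm_cast)).differentiableAt
      (by simp)).clm_apply (differentiableAt_const c)
  unfold christoffelFirst
  exact (((h _ _ _).add (h _ _ _)).sub (h _ _ _)).const_mul _

theorem IsPseudoRiemannian.christoffelFirst_add {g : MetricField E M}
    (hg : IsPseudoRiemannian g) (x : M) {y : E} (hy : y ∈ (chartAt E x).target)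
    (u v w w' : E) : christoffelFirst g x y u v (w + w') =
      christoffelFirst g x y u v w + christoffelFirst g x y u v w' := by
  have h : ∀ a b b' c, fderiv ℝ (fun z => metricInChart g x z a (b + b')) y c =
      fderiv ℝ (fun z => metricInChart g x z a b) y c +
      fderiv ℝ (fun z => metricInChart g x z a b') y c := fun a b b' c => by
    rw [← add_apply,
      ← fderiv_add (hg.differentiableAt x hy a b) (hg.differentiableAt x hy a b')]
    simp [metricInChart_eq, Pi.add_def]
  simp only [christoffelFirst, h, map_add]
  ring

theorem IsPseudoRiemannian.christoffelFirst_smul {g : MetricField E M}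
    (hg : IsPseudoRiemannian g) (x : M) {y : E} (hy : y ∈ (chartAt E x).target)
    (u v : E) (c : ℝ) (w : E) : christoffelFirst g x y u v (c • w) =
      c * christoffelFirst g x y u v w := by
  have h : ∀ a b c', fderiv ℝ (fun z => metricInChart g x z a (c • b)) y c' =
      c * fderiv ℝ (fun z => metricInChart g x z a b) y c' := fun a b c' => by
    rw [← smul_eq_mul, ← smul_apply,
      ← fderiv_const_smul (hg.differentiableAt x hy a b)]
    simp [metricInChart_eq, Pi.smul_def]
  simp only [christoffelFirst, h, map_smul, smul_eq_mul]
  ring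

variable [FiniteDimensional ℝ E]

/-- The Gram matrix of a bilinear form in the auxiliary basis. -/
def gram (b : E → E → ℝ) : Matrix (Fin (Module.finrank ℝ E)) (Fin (Module.finrank ℝ E)) ℝ :=
  Matrix.of fun k l => b (frame E k) (frame E l)

theorem isUnit_det_gram (b : E →L[ℝ] E →L[ℝ] ℝ) (hb : ∀ v, (∀ w, b v w = 0) → v = 0) :
    IsUnit (gram fun v w => b v w).det := by
  rw [isUnit_iff_ne_zero]
  intro h
  obtain ⟨c, hc, hc0⟩ := Matrix.exists_vecMul_eq_zero_iff.2 h
  refine hc ?_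
  have h0 : ∑ i, c i • frame E i = 0 := by
    refine hb _ fun w => ?_
    rw [← (frame E).sum_repr w]
    simp only [map_sum, map_smul, sum_apply, FunLike.coe_smul, smul_eq_mul,
      Pi.smul_apply]
    refine Finset.sum_eq_zero fun j _ => ?_
    have := congrFun hc0 j
    simp only [Matrix.vecMul, dotProduct, gram, Matrix.of_apply, Pi.zero_apply] at this
    simp [this]
  exact funext (Fintype.linearIndependent_iff.1 (frame E).linearIndependent c h0)

theorem sum_inverseForm (b : E →L[ℝ] E →L[ℝ] ℝ) (hb : ∀ v, (∀ w, b v w = 0) → v = 0)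
    (i k : Fin (Module.finrank ℝ E)) :
    ∑ j, inverseForm (fun v w => b v w) i j * b (frame E j) (frame E k) =
      if i = k then 1 else 0 := by
  have h := Matrix.nonsing_inv_mul _ (isUnit_det_gram b hb)
  have := congrFun (congrFun h i) k
  simpa [Matrix.mul_apply, gram, Matrix.one_apply, inverseForm] using this

/-- Both sides are linear in `w`, so it suffices to test on the auxiliary basis, where the inverse
Gram matrix cancels. -/
theorem IsPseudoRiemannian.metricInChart_christoffel [IsManifold 𝓘(ℝ, E) ∞ M]
    {g : MetricField E M} (hg : IsPseudoRiemannian g) (x : M) {y : E}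
    (hy : y ∈ (chartAt E x).target) (u v w : E) :
    metricInChart g x y (christoffel g x y u v) w = christoffelFirst g x y u v w := by
  have hb : ∀ v, (∀ w, chartForm g x y v w = 0) → v = 0 := fun v hv =>
    hg.metricInChart_nondegenerate x hy fun w => by rw [metricInChart_eq, hv]
  have key : ∀ k, metricInChart g x y (christoffel g x y u v) (frame E k) =
      christoffelFirst g x y u v (frame E k) := by
    intro k
    simp only [metricInChart_eq, christoffel, map_sum, map_smul, smul_eq_mul,
      sum_apply, FunLike.coe_smul, Pi.smul_apply, mul_right_comm _ _ (chartForm g x y _ _)]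
    simp only [← Finset.sum_mul, sum_inverseForm _ hb]
    simp
  let L : E →ₗ[ℝ] ℝ :=
    { toFun := christoffelFirst g x y u v
      map_add' := hg.christoffelFirst_add x hy u v
      map_smul' := hg.christoffelFirst_smul x hy u v }
  have : (chartForm g x y (christoffel g x y u v) : E →ₗ[ℝ] ℝ) = L :=
    (frame E).ext fun k => by
      have := key k
      rw [metricInChart_eq] at this
      exact this
  rw [metricInChart_eq]
  exact LinearMap.congr_fun this w

/-- By nondegeneracy, Christoffel symbols can be guessed and verified with the index lowered; no
Gram matrix has to be inverted for products or for warped metrics. -/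
theorem IsPseudoRiemannian.christoffel_eq [IsManifold 𝓘(ℝ, E) ∞ M]
    {g : MetricField E M} (hg : IsPseudoRiemannian g) (x : M) {y : E}
    (hy : y ∈ (chartAt E x).target) {u v e : E}
    (h : ∀ w, metricInChart g x y e w = christoffelFirst g x y u v w) :
    christoffel g x y u v = e :=
  hg.metricInChart_ext x hy fun w => by rw [hg.metricInChart_christoffel x hy, h]

theorem IsPseudoRiemannian.differentiableAt_christoffel [IsManifold 𝓘(ℝ, E) ∞ M]
    {g : MetricField E M} (hg : IsPseudoRiemannian g) (x : M) {y : E}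
    (hy : y ∈ (chartAt E x).target) (u v : E) :
    DifferentiableAt ℝ (fun z => christoffel g x z u v) y := by
  have hb : ∀ v, (∀ w, chartForm g x y v w = 0) → v = 0 := fun v hv =>
    hg.metricInChart_nondegenerate x hy fun w => by rw [metricInChart_eq, hv]
  have hdet : ∀ (A : E → Matrix (Fin (Module.finrank ℝ E)) (Fin (Module.finrank ℝ E)) ℝ),
      (∀ i j, DifferentiableAt ℝ (fun z => A z i j) y) →
      DifferentiableAt ℝ (fun z => (A z).det) y := by
    intro A hA
    simp only [Matrix.det_apply]
    refine DifferentiableAt.fun_sum fun σ _ => DifferentiableAt.const_smul ?_ _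
    exact (HasFDerivAt.finsetProd fun i _ => (hA (σ i) i).hasFDerivAt).differentiableAt
  have hG : ∀ i j, DifferentiableAt ℝ (fun z => gram (metricInChart g x z) i j) y :=
    fun i j => hg.differentiableAt x hy _ _
  have hne : (gram (metricInChart g x y)).det ≠ 0 := by
    have := isUnit_det_gram _ hb
    simp only [← metricInChart_eq] at this
    exact this.ne_zero
  have hinv : ∀ i j, DifferentiableAt ℝ (fun z => inverseForm (metricInChart g x z) i j) y := by
    intro i j
    -- Cramer's rule: each entry of the inverse is a quotient of determinants, which are polynomials
    -- in the metric components.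
    have : (fun z => inverseForm (metricInChart g x z) i j) = fun z =>
        ((gram (metricInChart g x z)).det)⁻¹ *
          ((gram (metricInChart g x z)).updateRow j (Pi.single i 1)).det := by
      funext z
      simp only [inverseForm, Matrix.inv_def, Matrix.smul_apply, smul_eq_mul,
        Ring.inverse_eq_inv, Matrix.adjugate_apply]
      rfl
    rw [this]
    refine ((hdet _ hG).fun_inv hne).mul (hdet _ fun k l => ?_)
    by_cases hk : k = j
    · subst hk
      simp
    · simpa [Matrix.updateRow_ne hk] using hG k l
  unfold christoffel
  exact DifferentiableAt.fun_sum fun i _ => DifferentiableAt.fun_sum fun j _ =>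
    ((hinv i j).mul (hg.differentiableAt_christoffelFirst x hy u v _)).smul_const _

/-- Metric compatibility of the connection, `∇g = 0`, in coordinates. -/
theorem IsPseudoRiemannian.fderiv_metricInChart [IsManifold 𝓘(ℝ, E) ∞ M]
    {g : MetricField E M} (hg : IsPseudoRiemannian g) (x : M) {y : E}
    (hy : y ∈ (chartAt E x).target) (u v w : E) :
    fderiv ℝ (fun z => metricInChart g x z v w) y u =
      metricInChart g x y (christoffel g x y u v) w +
        metricInChart g x y v (christoffel g x y u w) := by
  rw [hg.metricInChart_symm x y v, hg.metricInChart_christoffel x hy,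
    hg.metricInChart_christoffel x hy]
  have h : ∀ a b, (fun z => metricInChart g x z a b) = fun z => metricInChart g x z b a :=
    fun a b => funext fun z => hg.metricInChart_symm x z a b
  simp only [christoffelFirst]
  rw [h w v]
  ring

end Chart

/-! ### Connection and curvature of a product metric. -/

section Product

set_option linter.unusedSectionVars false

variable {ι : Type*} [Fintype ι] {E : ι → Type*} [∀ α, NormedAddCommGroup (E α)]
  [∀ α, NormedSpace ℝ (E α)] {M : ι → Type*} [∀ α, TopologicalSpace (M α)]
  [∀ α, ChartedSpace (E α) (M α)]

instance isManifold_pi [∀ α, IsManifold 𝓘(ℝ, E α) ∞ (M α)] :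
    IsManifold 𝓘(ℝ, ∀ α, E α) ∞ (∀ α, M α) := by
  refine isManifold_of_contDiffOn _ _ _ ?_
  rintro _ _ ⟨e, he, rfl⟩ ⟨e', he', rfl⟩
  refine contDiffOn_pi.2 fun α => ?_
  have h := ModelWithCorners.contDiffOn_extendCoordChange (I := 𝓘(ℝ, E α)) (n := ∞)
    (IsManifold.subset_maximalAtlas (he α (Set.mem_univ _)))
    (IsManifold.subset_maximalAtlas (he' α (Set.mem_univ _)))
  refine (h.comp (ContinuousLinearMap.proj (R := ℝ) (φ := E) α).contDiff.contDiffOn ?_).congr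
    fun z _ => rfl
  intro z hz
  have h1 := hz.1
  simp only [modelWithCornersSelf_coe_symm, Set.preimage_id_eq, id] at h1
  constructor
  · simpa using h1.1 α (Set.mem_univ _)
  · simpa using h1.2 α (Set.mem_univ _)

theorem mem_pi_chart_target (x : ∀ α, M α) {y : ∀ α, E α} :
    y ∈ (chartAt (∀ α, E α) x).target ↔ ∀ α, y α ∈ (chartAt (E α) (x α)).target := by
  change y ∈ Set.pi Set.univ _ ↔ _
  simp

/-- Transition maps between product charts act on each coordinate separately, hence so do their
derivatives. -/
theorem chartPush_pi [∀ α, IsManifold 𝓘(ℝ, E α) ∞ (M α)] (x : ∀ α, M α) {y : ∀ α, E α}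
    (hy : y ∈ (chartAt (∀ α, E α) x).target) (v : ∀ α, E α) (α : ι) :
    chartPush (∀ α, M α) x y v α = chartPush (M α) (x α) (y α) (v α) := by
  have h := hasFDerivAt_pi'.1 (hasFDerivAt_chartPush x hy) α
  have h2 := (hasFDerivAt_chartPush (x α) ((mem_pi_chart_target x).1 hy α)).comp y
    (ContinuousLinearMap.proj (R := ℝ) (φ := E) α).hasFDerivAt
  exact DFunLike.congr_fun (h.unique h2) v

/-- The metric of one factor, as a tensor field on the product. -/
def blockMetric (g : ∀ α, MetricField (E α) (M α)) (α : ι) :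
    TensorField (∀ α, E α) (∀ α, M α) 2 :=
  fun p v => g α (p α) (v 0 α) (v 1 α)

theorem productMetric_apply (g : ∀ α, MetricField (E α) (M α)) (p : ∀ α, M α) (v w : ∀ α, E α) :
    productMetric g p v w = ∑ α, g α (p α) (v α) (w α) := by
  simp [productMetric]

theorem chartAt_pi_symm (x : ∀ α, M α) (y : ∀ α, E α) (α : ι) :
    (chartAt (∀ α, E α) x).symm y α = (chartAt (E α) (x α)).symm (y α) := rfl

theorem metricInChart_productMetric [∀ α, IsManifold 𝓘(ℝ, E α) ∞ (M α)]
    (g : ∀ α, MetricField (E α) (M α)) (x : ∀ α, M α) {y : ∀ α, E α}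
    (hy : y ∈ (chartAt (∀ α, E α) x).target) (v w : ∀ α, E α) :
    metricInChart (productMetric g) x y v w =
      ∑ α, metricInChart (g α) (x α) (y α) (v α) (w α) := by
  simp only [metricInChart_eq, chartForm, ContinuousLinearMap.bilinearComp_apply,
    productMetric_apply, chartPush_pi x hy, chartAt_pi_symm]

theorem IsPseudoRiemannian.productMetric [∀ α, IsManifold 𝓘(ℝ, E α) ∞ (M α)]
    {g : ∀ α, MetricField (E α) (M α)} (hg : ∀ α, IsPseudoRiemannian (g α)) :
    IsPseudoRiemannian (productMetric g) where
  symm p v w := by simp only [productMetric_apply, (hg _).symm _ (v _)]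
  nondegenerate p v hv := by
    classical
    funext α
    refine (hg α).nondegenerate (p α) _ fun w => ?_
    have := hv (Pi.single α w)
    rw [productMetric_apply, Finset.sum_eq_single α] at this
    · simpa using this
    · intro β _ hβ
      simp [Pi.single_eq_of_ne hβ]
    · simp
  smooth x v w := by
    refine ContDiffOn.congr (f := fun y : ∀ α, E α =>
      ∑ α, metricInChart (g α) (x α) (y α) (v α) (w α)) ?_
      fun y hy => metricInChart_productMetric g x hy v w
    refine ContDiffOn.sum fun α _ => ?_
    exact ((hg α).smooth (x α) (v α) (w α)).comp (ContinuousLinearMap.proj (R := ℝ) (φ := E) α).contDiff.contDiffOn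
      fun y hy => (mem_pi_chart_target x).1 hy α

theorem fderiv_comp_eval {F : Type*} [NormedAddCommGroup F] [NormedSpace ℝ F] (α : ι)
    {f : E α → F} {y : ∀ α, E α} (hf : DifferentiableAt ℝ f (y α)) (u : ∀ α, E α) :
    fderiv ℝ (fun z : ∀ α, E α => f (z α)) y u = fderiv ℝ f (y α) (u α) :=
  DFunLike.congr_fun (hf.hasFDerivAt.comp y
    (ContinuousLinearMap.proj (R := ℝ) (φ := E) α).hasFDerivAt).fderiv u

theorem differentiableAt_comp_eval {F : Type*} [NormedAddCommGroup F] [NormedSpace ℝ F] (α : ι)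
    {f : E α → F} {y : ∀ α, E α} (hf : DifferentiableAt ℝ f (y α)) :
    DifferentiableAt ℝ (fun z : ∀ α, E α => f (z α)) y :=
  hf.comp y (differentiableAt_apply α y)

theorem eventually_mem_target (x : ∀ α, M α) {y : ∀ α, E α}
    (hy : y ∈ (chartAt (∀ α, E α) x).target) :
    ∀ᶠ z in nhds y, z ∈ (chartAt (∀ α, E α) x).target :=
  (chartAt (∀ α, E α) x).open_target.mem_nhds hy

theorem christoffelFirst_productMetric [∀ α, IsManifold 𝓘(ℝ, E α) ∞ (M α)]
    {g : ∀ α, MetricField (E α) (M α)} (hg : ∀ α, IsPseudoRiemannian (g α))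
    (x : ∀ α, M α) {y : ∀ α, E α} (hy : y ∈ (chartAt (∀ α, E α) x).target) (u v w : ∀ α, E α) :
    christoffelFirst (productMetric g) x y u v w =
      ∑ α, christoffelFirst (g α) (x α) (y α) (u α) (v α) (w α) := by
  have hy' := (mem_pi_chart_target x).1 hy
  have h : ∀ a b c : ∀ α, E α,
      fderiv ℝ (fun z => metricInChart (productMetric g) x z a b) y c =
        ∑ α, fderiv ℝ (fun z => metricInChart (g α) (x α) z (a α) (b α)) (y α) (c α) := by
    intro a b c
    have he : (fun z => metricInChart (productMetric g) x z a b) =ᶠ[nhds y]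
        fun z => ∑ α, metricInChart (g α) (x α) (z α) (a α) (b α) := by
      filter_upwards [eventually_mem_target x hy] with z hz
      exact metricInChart_productMetric g x hz a b
    rw [he.fderiv_eq, fderiv_fun_sum fun α _ => differentiableAt_comp_eval α
      (f := fun z => metricInChart (g α) (x α) z (a α) (b α))
      ((hg α).differentiableAt (x α) (hy' α) _ _), sum_apply]
    exact Finset.sum_congr rfl fun α _ => fderiv_comp_eval α
      (f := fun z => metricInChart (g α) (x α) z (a α) (b α))
      ((hg α).differentiableAt (x α) (hy' α) _ _) c
  simp only [christoffelFirst, h, ← Finset.sum_add_distrib, ← Finset.sum_sub_distrib,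
    Finset.mul_sum]

variable [∀ α, FiniteDimensional ℝ (E α)]

theorem christoffel_productMetric [∀ α, IsManifold 𝓘(ℝ, E α) ∞ (M α)]
    {g : ∀ α, MetricField (E α) (M α)} (hg : ∀ α, IsPseudoRiemannian (g α))
    (x : ∀ α, M α) {y : ∀ α, E α} (hy : y ∈ (chartAt (∀ α, E α) x).target) (u v : ∀ α, E α) :
    christoffel (productMetric g) x y u v =
      fun α => christoffel (g α) (x α) (y α) (u α) (v α) := by
  refine (IsPseudoRiemannian.productMetric hg).christoffel_eq x hy fun w => ?_
  rw [metricInChart_productMetric g x hy, christoffelFirst_productMetric hg x hy]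
  exact Finset.sum_congr rfl fun α _ =>
    (hg α).metricInChart_christoffel _ ((mem_pi_chart_target x).1 hy α) _ _ _

theorem curvature_productMetric [∀ α, IsManifold 𝓘(ℝ, E α) ∞ (M α)]
    {g : ∀ α, MetricField (E α) (M α)} (hg : ∀ α, IsPseudoRiemannian (g α))
    (p : ∀ α, M α) (u v w : ∀ α, E α) (α : ι) :
    curvature (productMetric g) p u v w α = curvature (g α) (p α) (u α) (v α) (w α) := by
  have hy : chartAt (∀ α, E α) p p ∈ (chartAt (∀ α, E α) p).target := mem_chart_target _ p
  have hy' := (mem_pi_chart_target p).1 hy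
  have h : ∀ a b c : ∀ α, E α,
      fderiv ℝ (fun z => christoffel (productMetric g) p z a b) (chartAt (∀ α, E α) p p) c α =
        fderiv ℝ (fun z => christoffel (g α) (p α) z (a α) (b α))
          (chartAt (E α) (p α) (p α)) (c α) := by
    intro a b c
    have he : (fun z => christoffel (productMetric g) p z a b)
        =ᶠ[nhds (chartAt (∀ α, E α) p p)]
        fun z α => christoffel (g α) (p α) (z α) (a α) (b α) := by
      filter_upwards [eventually_mem_target p hy] with z hz
      exact christoffel_productMetric hg p hz a b
    rw [he.fderiv_eq, fderiv_pi fun α => differentiableAt_comp_eval α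
      (f := fun z => christoffel (g α) (p α) z (a α) (b α))
      ((hg α).differentiableAt_christoffel (p α) (hy' α) _ _)]
    exact fderiv_comp_eval α
      (f := fun z => christoffel (g α) (p α) z (a α) (b α))
      ((hg α).differentiableAt_christoffel (p α) (hy' α) _ _) c
  simp only [curvature, christoffel_productMetric hg p hy, Pi.sub_apply, Pi.add_apply, h]
  rfl

theorem riemann_productMetric [∀ α, IsManifold 𝓘(ℝ, E α) ∞ (M α)]
    {g : ∀ α, MetricField (E α) (M α)} (hg : ∀ α, IsPseudoRiemannian (g α))
    (p : ∀ α, M α) (v : Fin 4 → ∀ α, E α) :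
    riemann (productMetric g) p v = ∑ α, riemann (g α) (p α) fun i => v i α := by
  simp only [riemann, productMetric_apply, curvature_productMetric hg]

theorem inChart_blockMetric [∀ α, IsManifold 𝓘(ℝ, E α) ∞ (M α)]
    (g : ∀ α, MetricField (E α) (M α)) (α : ι) (x : ∀ α, M α) {y : ∀ α, E α}
    (hy : y ∈ (chartAt (∀ α, E α) x).target) (v w : ∀ α, E α) :
    TensorField.inChart (blockMetric g α) x y ![v, w] =
      metricInChart (g α) (x α) (y α) (v α) (w α) := by
  simp only [TensorField.inChart, blockMetric, metricInChart_eq, chartForm, chartPush_pi x hy,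
    chartAt_pi_symm, ContinuousLinearMap.bilinearComp_apply]
  rfl

theorem differentiableAt_inChart_blockMetric [∀ α, IsManifold 𝓘(ℝ, E α) ∞ (M α)]
    {g : ∀ α, MetricField (E α) (M α)} (hg : ∀ α, IsPseudoRiemannian (g α)) (α : ι)
    (p : ∀ α, M α) (v w : ∀ α, E α) :
    DifferentiableAt ℝ (fun z => TensorField.inChart (blockMetric g α) p z ![v, w])
      (chartAt (∀ α, E α) p p) := by
  have hy : chartAt (∀ α, E α) p p ∈ (chartAt (∀ α, E α) p).target := mem_chart_target _ p
  have he : (fun z => TensorField.inChart (blockMetric g α) p z ![v, w])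
      =ᶠ[nhds (chartAt (∀ α, E α) p p)]
      fun z => metricInChart (g α) (p α) (z α) (v α) (w α) := by
    filter_upwards [eventually_mem_target p hy] with z hz
    exact inChart_blockMetric g α p hz v w
  rw [he.differentiableAt_iff]
  exact differentiableAt_comp_eval α (f := fun z => metricInChart (g α) (p α) z (v α) (w α))
    ((hg α).differentiableAt (p α) ((mem_pi_chart_target p).1 hy α) _ _)

/-- This is `∇ g_α = 0` on the product: the product connection acts in the factor `α` as the
connection of `g α`, which is compatible with `g α`. -/
theorem fderiv_inChart_blockMetric [∀ α, IsManifold 𝓘(ℝ, E α) ∞ (M α)]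
    {g : ∀ α, MetricField (E α) (M α)} (hg : ∀ α, IsPseudoRiemannian (g α)) (α : ι)
    (p : ∀ α, M α) (u v w : ∀ α, E α) :
    fderiv ℝ (fun z => TensorField.inChart (blockMetric g α) p z ![v, w])
      (chartAt (∀ α, E α) p p) u =
    blockMetric g α p ![christoffel (productMetric g) p (chartAt (∀ α, E α) p p) u v, w] +
      blockMetric g α p ![v, christoffel (productMetric g) p (chartAt (∀ α, E α) p p) u w] := by
  have hy : chartAt (∀ α, E α) p p ∈ (chartAt (∀ α, E α) p).target := mem_chart_target _ p
  have hy' := (mem_pi_chart_target p).1 hy α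
  have he : (fun z => TensorField.inChart (blockMetric g α) p z ![v, w])
      =ᶠ[nhds (chartAt (∀ α, E α) p p)]
      fun z => metricInChart (g α) (p α) (z α) (v α) (w α) := by
    filter_upwards [eventually_mem_target p hy] with z hz
    exact inChart_blockMetric g α p hz v w
  rw [he.fderiv_eq, fderiv_comp_eval α
    (f := fun z => metricInChart (g α) (p α) z (v α) (w α))
    ((hg α).differentiableAt (p α) hy' _ _),
    (hg α).fderiv_metricInChart _ hy']
  simp only [christoffel_productMetric hg p hy, blockMetric, Matrix.cons_val_zero,
    Matrix.cons_val_one]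
  rw [show chartAt (∀ α, E α) p p α = chartAt (E α) (p α) (p α) from rfl,
    metricInChart_self, metricInChart_self]

end Product

/-! ### Parallel tensors on a product of spaces of constant curvature. -/

section Parallel

set_option linter.unusedSectionVars false

variable {ι : Type*} [Fintype ι] {E : ι → Type*} [∀ α, NormedAddCommGroup (E α)]
  [∀ α, NormedSpace ℝ (E α)] {M : ι → Type*} [∀ α, TopologicalSpace (M α)]
  [∀ α, ChartedSpace (E α) (M α)] [∀ α, FiniteDimensional ℝ (E α)]
  [∀ α, IsManifold 𝓘(ℝ, E α) ∞ (M α)]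

/-- The product tensor whose value on each factor is the constant curvature tensor `K α`. -/
def blockRiemann (g : ∀ α, MetricField (E α) (M α)) (K : ι → ℝ) :
    TensorField (∀ α, E α) (∀ α, M α) 4 :=
  fun p v => ∑ α, K α * (blockMetric g α p ![v 0, v 2] * blockMetric g α p ![v 1, v 3] -
    blockMetric g α p ![v 0, v 3] * blockMetric g α p ![v 1, v 2])

theorem riemann_productMetric_of_constant {g : ∀ α, MetricField (E α) (M α)}
    (hg : ∀ α, IsPseudoRiemannian (g α)) {K : ι → ℝ}
    (hK : ∀ α (p : M α) (a b c d : E α), riemann (g α) p ![a, b, c, d] =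
      K α * (g α p a c * g α p b d - g α p a d * g α p b c)) :
    riemann (productMetric g) = blockRiemann g K := by
  funext p v
  rw [riemann_productMetric hg, blockRiemann]
  refine Finset.sum_congr rfl fun α _ => ?_
  have h : (fun i => v i α) = ![v 0 α, v 1 α, v 2 α, v 3 α] := by
    funext i; fin_cases i <;> rfl
  rw [h, hK]
  simp [blockMetric]

theorem covDeriv_zero (g : MetricField (∀ α, E α) (∀ α, M α)) {r : ℕ} :
    covDeriv g (0 : TensorField (∀ α, E α) (∀ α, M α) r) = 0 := by
  funext p v
  simp [covDeriv, TensorField.inChart]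

theorem covDeriv_sum_blockMetric {g : ∀ α, MetricField (E α) (M α)}
    (hg : ∀ α, IsPseudoRiemannian (g α)) (c : ι → ℝ) :
    covDeriv (productMetric g) (fun p v => ∑ α, c α * blockMetric g α p v) = 0 := by
  funext p v
  have h : ∀ (w : Fin 2 → ∀ α, E α), w = ![w 0, w 1] := fun w => by
    funext i; fin_cases i <;> rfl
  have hfun : ∀ w : Fin 2 → ∀ α, E α, (fun z => TensorField.inChart
      (fun p v => ∑ α, c α * blockMetric g α p v) p z w) =
      fun z => ∑ α, c α * (blockMetric g α).inChart p z ![w 0, w 1] := fun w => by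
    rw [← h w]; rfl
  simp only [covDeriv]
  rw [hfun, fderiv_fun_sum fun α _ =>
    (differentiableAt_inChart_blockMetric hg α p _ _).const_mul (c α), sum_apply,
    Fin.sum_univ_two, ← Finset.sum_add_distrib, ← Finset.sum_sub_distrib]
  refine Finset.sum_eq_zero fun α _ => ?_
  rw [fderiv_const_mul (differentiableAt_inChart_blockMetric hg α p _ _), smul_apply,
    fderiv_inChart_blockMetric hg, h (Function.update _ _ _), h (Function.update _ 1 _)]
  simp [Function.update]
  ring

/-- A constant-coefficient polynomial in the parallel block metrics is parallel, by the Leibniz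
rule. -/
theorem covDeriv_blockRiemann {g : ∀ α, MetricField (E α) (M α)}
    (hg : ∀ α, IsPseudoRiemannian (g α)) (K : ι → ℝ) :
    covDeriv (productMetric g) (blockRiemann g K) = 0 := by
  funext p v
  have hd := fun α v w => differentiableAt_inChart_blockMetric hg α p v w
  have hfun : ∀ w : Fin 4 → ∀ α, E α, (fun z => (blockRiemann g K).inChart p z w) =
      fun z => ∑ α, K α *
        ((blockMetric g α).inChart p z ![w 0, w 2] * (blockMetric g α).inChart p z ![w 1, w 3] -
        (blockMetric g α).inChart p z ![w 0, w 3] * (blockMetric g α).inChart p z ![w 1, w 2]) := by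
    intro w
    rfl
  simp only [covDeriv]
  rw [hfun, fderiv_fun_sum fun α _ =>
    (((hd α _ _).fun_mul (hd α _ _)).fun_sub ((hd α _ _).fun_mul (hd α _ _))).const_mul (K α),
    sum_apply]
  simp only [blockRiemann]
  rw [Fin.sum_univ_four, ← Finset.sum_add_distrib, ← Finset.sum_add_distrib,
    ← Finset.sum_add_distrib, ← Finset.sum_sub_distrib]
  refine Finset.sum_eq_zero fun α _ => ?_
  rw [fderiv_const_mul (((hd α _ _).fun_mul (hd α _ _)).fun_sub ((hd α _ _).fun_mul (hd α _ _))),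
    fderiv_fun_sub ((hd α _ _).fun_mul (hd α _ _)) ((hd α _ _).fun_mul (hd α _ _)),
    fderiv_fun_mul (hd α _ _) (hd α _ _), fderiv_fun_mul (hd α _ _) (hd α _ _)]
  simp only [smul_apply, sub_apply, add_apply, fderiv_inChart_blockMetric hg,
    TensorField.inChart_self, smul_eq_mul]
  simp [Function.update]
  ring

theorem nablaRiemann_succ_productMetric {g : ∀ α, MetricField (E α) (M α)}
    (hg : ∀ α, IsPseudoRiemannian (g α)) {K : ι → ℝ}
    (hK : ∀ α (p : M α) (a b c d : E α), riemann (g α) p ![a, b, c, d] =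
      K α * (g α p a c * g α p b d - g α p a d * g α p b c)) (k : ℕ) :
    nablaRiemann (productMetric g) (k + 1) = 0 := by
  induction k with
  | zero =>
    simp only [nablaRiemann]
    rw [riemann_productMetric_of_constant hg hK, covDeriv_blockRiemann hg]
  | succ k ih =>
    rw [nablaRiemann, ih, covDeriv_zero]

end Parallel

/-! ### Metric traces, curvature contractions and complex orthonormal coframes. -/

section Trace

set_option linter.unusedSectionVars false

variable {E : Type*} [NormedAddCommGroup E] [NormedSpace ℝ E] [FiniteDimensional ℝ E]
  {M : Type*} [TopologicalSpace M] [ChartedSpace E M]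

/-- The trace with respect to the metric of a function of two tangent vectors. -/
def metricTrace (g : MetricField E M) (p : M) (F : E → E → ℝ) : ℝ :=
  ∑ i, ∑ j, inverseMetric g p i j * F (frame E i) (frame E j)

theorem metricTrace_sum (g : MetricField E M) (p : M) {κ : Type*} [Fintype κ]
    (F : κ → E → E → ℝ) :
    metricTrace g p (fun a b => ∑ k, F k a b) = ∑ k, metricTrace g p (F k) := by
  simp only [metricTrace, Finset.mul_sum]
  rw [Finset.sum_comm]
  simp_rw [fun j => Finset.sum_comm (s := Finset.univ) (t := Finset.univ)
    (f := fun i k => inverseMetric g p i j * F k (frame E i) (frame E j))]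
  rw [Finset.sum_comm]
  exact Finset.sum_congr rfl fun k _ => Finset.sum_comm

theorem metricTrace_sub (g : MetricField E M) (p : M) (F G : E → E → ℝ) :
    metricTrace g p (fun a b => F a b - G a b) = metricTrace g p F - metricTrace g p G := by
  simp only [metricTrace, mul_sub, Finset.sum_sub_distrib]

theorem metricTrace_add (g : MetricField E M) (p : M) (F G : E → E → ℝ) :
    metricTrace g p (fun a b => F a b + G a b) = metricTrace g p F + metricTrace g p G := by
  simp only [metricTrace, mul_add, Finset.sum_add_distrib]

theorem metricTrace_const_mul (g : MetricField E M) (p : M) (c : ℝ) (F : E → E → ℝ) :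
    metricTrace g p (fun a b => c * F a b) = c * metricTrace g p F := by
  simp only [metricTrace, Finset.mul_sum, mul_left_comm c]

theorem contract_eq_metricTrace (g : MetricField E M) {r : ℕ} (T : TensorField E M (r + 2))
    (p : M) (v : Fin r → E) :
    contract g T p v =
      metricTrace g p fun a b => T p (Matrix.vecCons a (Matrix.vecCons b v)) := rfl

theorem ricci_eq_metricTrace (g : MetricField E M) (p : M) (v : Fin 2 → E) :
    ricci g p v = metricTrace g p fun a b => riemann g p ![a, v 0, b, v 1] := rfl

theorem ricciScalar_eq_metricTrace (g : MetricField E M) (p : M) :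
    ricciScalar g p = metricTrace g p fun a b => ricci g p ![a, b] := rfl

theorem IsPseudoRiemannian.metricTrace_self {g : MetricField E M} (hg : IsPseudoRiemannian g)
    (p : M) : metricTrace g p (fun a b => g p a b) = Module.finrank ℝ E := by
  have h := sum_inverseForm (g p) (hg.nondegenerate p)
  simp only [metricTrace, inverseMetric]
  have : ∀ i, ∑ j, inverseForm (fun v w => g p v w) i j * g p (frame E j) (frame E i) = 1 :=
    fun i => by rw [h]; simp
  calc _ = ∑ i, ∑ j, inverseForm (fun v w => g p v w) i j * g p (frame E j) (frame E i) :=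
        Finset.sum_congr rfl fun i _ => Finset.sum_congr rfl fun j _ => by
          rw [hg.symm p (frame E i)]
    _ = _ := by simp [this]

/-- Raising an index and lowering it again is the identity: `g^{ab} L_a x_b = L_a x^a`. -/
theorem IsPseudoRiemannian.metricTrace_linear {g : MetricField E M} (hg : IsPseudoRiemannian g)
    (p : M) (L : E →L[ℝ] ℝ) (x : E) : metricTrace g p (fun a b => L a * g p b x) = L x := by
  have h := sum_inverseForm (g p) (hg.nondegenerate p)
  have hx : ∀ i, ∑ j, inverseForm (fun v w => g p v w) i j * g p (frame E j) x =
      (frame E).repr x i := by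
    intro i
    conv_lhs => rw [← (frame E).sum_repr x]
    simp only [map_sum, map_smul, smul_eq_mul, Finset.mul_sum]
    rw [Finset.sum_comm]
    simp only [mul_left_comm _ ((frame E).repr x _), ← Finset.mul_sum, h]
    simp
  simp only [metricTrace, inverseMetric, mul_left_comm _ (L _), ← Finset.mul_sum, hx]
  conv_rhs => rw [← (frame E).sum_repr x, map_sum]
  exact Finset.sum_congr rfl fun i _ => by rw [map_smul, smul_eq_mul, mul_comm]

theorem ricci_of_constant {g : MetricField E M} (hg : IsPseudoRiemannian g) {K : ℝ}
    (hK : ∀ (p : M) (a b c d : E), riemann g p ![a, b, c, d] =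
      K * (g p a c * g p b d - g p a d * g p b c)) (p : M) (v w : E) :
    ricci g p ![v, w] = (Module.finrank ℝ E - 1) * K * g p v w := by
  rw [ricci_eq_metricTrace]
  simp only [hK, Matrix.cons_val_zero, Matrix.cons_val_one]
  rw [metricTrace_const_mul, metricTrace_sub]
  have h1 : metricTrace g p (fun a b => g p a b * g p v w) =
      Module.finrank ℝ E * g p v w := by
    simp only [mul_comm _ (g p v w), metricTrace_const_mul, hg.metricTrace_self]
  have h2 : metricTrace g p (fun a b => g p a w * g p v b) = g p v w := by
    have := hg.metricTrace_linear p (g p w) v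
    simp only [hg.symm p w] at this
    simpa only [hg.symm p v] using this
  rw [h1, h2]
  ring

theorem ricciScalar_of_constant {g : MetricField E M} (hg : IsPseudoRiemannian g) {K : ℝ}
    (hK : ∀ (p : M) (a b c d : E), riemann g p ![a, b, c, d] =
      K * (g p a c * g p b d - g p a d * g p b c)) (p : M) :
    ricciScalar g p = Module.finrank ℝ E * (Module.finrank ℝ E - 1) * K := by
  rw [ricciScalar_eq_metricTrace]
  simp only [ricci_of_constant hg hK, metricTrace_const_mul, hg.metricTrace_self]
  ring

/-- Complex linear forms `θ i` with `b v w = ∑ i, θ i v * θ i w`. -/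
def IsCoframe {κ : Type*} [Fintype κ] (b : E → E → ℝ) (θ : κ → E →ₗ[ℝ] ℂ) : Prop :=
  ∀ v w, (b v w : ℂ) = ∑ i, θ i v * θ i w

/-- Diagonalize `b` over the reals and scale the dual basis by complex square roots of the diagonal
entries. Complex values make all signatures look alike. -/
theorem exists_isCoframe (b : E →L[ℝ] E →L[ℝ] ℝ) (hb : ∀ v w, b v w = b w v) {n : ℕ}
    (hn : Module.finrank ℝ E = n) :
    ∃ θ : Fin n → E →ₗ[ℝ] ℂ, IsCoframe (fun v w => b v w) θ := by
  subst hn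
  let B : LinearMap.BilinForm ℝ E := LinearMap.mk₂ ℝ (fun v w => b v w)
    (by simp) (by simp) (by simp) (by simp)
  have hB : LinearMap.IsSymm B := ⟨fun v w => by simp [B, hb v w]⟩
  obtain ⟨e, he⟩ := LinearMap.BilinForm.exists_orthogonal_basis (B := B) hB
  have hd : ∀ i, ∃ c : ℂ, c ^ 2 = (B (e i) (e i) : ℂ) := fun i =>
    IsAlgClosed.exists_pow_nat_eq _ (by norm_num)
  choose c hc using hd
  refine ⟨fun i => (c i) • (Complex.ofRealCLM : ℝ →ₗ[ℝ] ℂ).comp (e.coord i), fun v w => ?_⟩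
  have h1 : b v w = ∑ i, e.repr v i * e.repr w i * B (e i) (e i) := by
    change B v w = _
    conv_lhs => rw [← e.sum_repr v, ← e.sum_repr w]
    simp only [map_sum, map_smul, LinearMap.sum_apply, LinearMap.smul_apply, smul_eq_mul]
    refine Finset.sum_congr rfl fun i _ => ?_
    rw [Finset.sum_eq_single i]
    · ring
    · intro j _ hj
      rw [show B (e j) (e i) = 0 from he hj]
      ring
    · simp
  change ((b v w : ℝ) : ℂ) = _
  rw [h1]
  push_cast
  refine Finset.sum_congr rfl fun i _ => ?_
  rw [← hc i]
  simp
  ring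

/-- With `F` the matrix of the coframe and `G` the Gram matrix, `F Fᵀ = G`, so `(G⁻¹ F) Fᵀ = 1`. As
the index sets have equal size, the factors may be exchanged, giving `Fᵀ G⁻¹ F = 1`. -/
theorem IsCoframe.sum_inverseForm {κ : Type*} [Fintype κ] [DecidableEq κ]
    {b : E →L[ℝ] E →L[ℝ] ℝ} (hb : ∀ v, (∀ w, b v w = 0) → v = 0)
    {θ : κ → E →ₗ[ℝ] ℂ} (hθ : IsCoframe (fun v w => b v w) θ)
    (hκ : Fintype.card κ = Module.finrank ℝ E) (I J : κ) :
    ∑ i, ∑ j, (inverseForm (fun v w => b v w) i j : ℂ) *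
      (θ I (frame E i) * θ J (frame E j)) = if I = J then 1 else 0 := by
  let F : Matrix (Fin (Module.finrank ℝ E)) κ ℂ := Matrix.of fun i I => θ I (frame E i)
  let H : Matrix (Fin (Module.finrank ℝ E)) (Fin (Module.finrank ℝ E)) ℂ :=
    Matrix.of fun i j => (inverseForm (fun v w => b v w) i j : ℂ)
  have h1 : (H * F) * F.transpose = 1 := by
    rw [Matrix.mul_assoc]
    ext i k
    have := PseudoRiem.sum_inverseForm b hb i k
    simp only [Matrix.mul_apply, F, H, Matrix.of_apply, Matrix.transpose_apply, ← hθ _ _,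
      Matrix.one_apply, ← Complex.ofReal_mul, ← Complex.ofReal_sum, this]
    split_ifs <;> simp
  have h2 : F.transpose * (H * F) = 1 :=
    (Matrix.mul_eq_one_comm_of_card_eq _ _ _ (by simp [hκ])).1 h1
  have := congrFun (congrFun h2 I) J
  simp only [Matrix.mul_apply, F, H, Matrix.of_apply, Matrix.transpose_apply,
    Matrix.one_apply, Finset.mul_sum] at this
  rw [← this]
  exact Finset.sum_congr rfl fun i _ => Finset.sum_congr rfl fun j _ => by ring

end Trace

/-! ### Traces of block metrics over the product. -/

section BlockTrace

set_option linter.unusedSectionVars false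

variable {ι : Type*} [Fintype ι] {E : ι → Type*} [∀ α, NormedAddCommGroup (E α)]
  [∀ α, NormedSpace ℝ (E α)] {M : ι → Type*} [∀ α, TopologicalSpace (M α)]
  [∀ α, ChartedSpace (E α) (M α)] [∀ α, FiniteDimensional ℝ (E α)]
  [∀ α, IsManifold 𝓘(ℝ, E α) ∞ (M α)]

theorem metricTrace_block [DecidableEq ι] {g : ∀ α, MetricField (E α) (M α)}
    (hg : ∀ α, IsPseudoRiemannian (g α)) (p : ∀ α, M α) (α : ι) :
    metricTrace (productMetric g) p (fun a b => g α (p α) (a α) (b α)) =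
      Module.finrank ℝ (E α) := by
  have hex := fun β => exists_isCoframe (g β (p β)) ((hg β).symm (p β)) rfl
  choose θ hθ using hex
  let Θ : (Σ β, Fin (Module.finrank ℝ (E β))) → (∀ β, E β) →ₗ[ℝ] ℂ :=
    fun I => (θ I.1 I.2).comp (LinearMap.proj I.1)
  have hΘ : IsCoframe (fun v w => productMetric g p v w) Θ := by
    intro v w
    simp only [Fintype.sum_sigma, productMetric_apply]
    push_cast
    exact Finset.sum_congr rfl fun β _ => hθ β (v β) (w β)
  have hcard : Fintype.card (Σ β, Fin (Module.finrank ℝ (E β))) =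
      Module.finrank ℝ (∀ β, E β) := by
    simp [Module.finrank_pi_fintype]
  have key := hΘ.sum_inverseForm
    ((IsPseudoRiemannian.productMetric hg).nondegenerate p) hcard
  apply Complex.ofReal_injective
  have h : ∀ v w : ∀ β, E β, (g α (p α) (v α) (w α) : ℂ) = ∑ i, Θ ⟨α, i⟩ v * Θ ⟨α, i⟩ w :=
    fun v w => hθ α (v α) (w α)
  simp only [metricTrace, inverseMetric]
  push_cast
  simp only [h, Finset.mul_sum]
  simp_rw [fun i => Finset.sum_comm (s := Finset.univ) (t := Finset.univ)
    (f := fun j k => (inverseForm (fun v w => productMetric g p v w) i j : ℂ) *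
      (Θ ⟨α, k⟩ (frame _ i) * Θ ⟨α, k⟩ (frame _ j)))]
  rw [Finset.sum_comm]
  simp [key]

theorem metricTrace_block_mul_block [DecidableEq ι] {g : ∀ α, MetricField (E α) (M α)}
    (hg : ∀ α, IsPseudoRiemannian (g α)) (p : ∀ α, M α) (α β : ι) (v : E α) (w : E β) :
    metricTrace (productMetric g) p (fun a b => g α (p α) v (a α) * g β (p β) w (b β)) =
      g α (p α) v ((Pi.single β w : ∀ α, E α) α) := by
  have h := (IsPseudoRiemannian.productMetric hg).metricTrace_linear p
    ((g α (p α) v).comp (ContinuousLinearMap.proj (R := ℝ) (φ := E) α)) (Pi.single β w)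
  have h2 : ∀ b : ∀ α, E α, productMetric g p b (Pi.single β w) = g β (p β) w (b β) := by
    intro b
    rw [productMetric_apply, Finset.sum_eq_single β]
    · simp [(hg β).symm _ w]
    · intro γ _ hγ
      simp [Pi.single_eq_of_ne hγ]
    · simp
  simp only [h2] at h
  exact h

end BlockTrace

/-! ### Tensors with constant, symmetric components in a coframe. -/

section InvariantArray

set_option linter.unusedSectionVars false

variable {κ : Type*} [Fintype κ]

theorem sum_vec_two (f : (Fin 2 → κ) → ℂ) : ∑ I, f I = ∑ a, ∑ b, f ![a, b] := by
  rw [← (finTwoArrowEquiv κ).symm.sum_comp, Fintype.sum_prod_type]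
  rfl

theorem sum_vecCons {r : ℕ} (f : (Fin (r + 1) → κ) → ℂ) :
    ∑ I, f I = ∑ a, ∑ I : Fin r → κ, f (Matrix.vecCons a I) := by
  rw [← (Fin.consEquiv fun _ => κ).sum_comp, Fintype.sum_prod_type]
  rfl

theorem sum_vec_four (f : (Fin 4 → κ) → ℂ) :
    ∑ I, f I = ∑ a, ∑ b, ∑ c, ∑ d, f ![a, b, c, d] := by
  rw [sum_vecCons]
  refine Finset.sum_congr rfl fun a _ => ?_
  rw [sum_vecCons]
  exact Finset.sum_congr rfl fun b _ => sum_vec_two _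

theorem sum_comm_pairs {κ' : Type*} [Fintype κ'] (F : κ' → κ' → κ → κ → ℂ) :
    ∑ i, ∑ j, ∑ a, ∑ b, F i j a b = ∑ a, ∑ b, ∑ i, ∑ j, F i j a b :=
  calc _ = ∑ i, ∑ a, ∑ j, ∑ b, F i j a b :=
        Finset.sum_congr rfl fun _ _ => Finset.sum_comm
    _ = ∑ a, ∑ i, ∑ j, ∑ b, F i j a b := Finset.sum_comm
    _ = ∑ a, ∑ i, ∑ b, ∑ j, F i j a b :=
        Finset.sum_congr rfl fun _ _ => Finset.sum_congr rfl fun _ _ => Finset.sum_comm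
    _ = _ := Finset.sum_congr rfl fun _ _ => Finset.sum_comm

/-- Arrays of components which are unchanged by the permutations of the frame in `S` and by all
changes of sign of the frame vectors. -/
structure IsInvariantArray (S : Set (Equiv.Perm κ)) {r : ℕ} (A : (Fin r → κ) → ℂ) : Prop where
  perm : ∀ σ ∈ S, ∀ I, A (fun k => σ (I k)) = A I
  sign : ∀ ε : κ → ℂ, (∀ a, ε a * ε a = 1) → ∀ I, (∏ k, ε (I k)) * A I = A I

variable {S : Set (Equiv.Perm κ)}

/-- A permutation only relabels the summation index, and a sign attached to it occurs twice and so
squares to 1. -/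
theorem IsInvariantArray.contract {r : ℕ} {A : (Fin (r + 2) → κ) → ℂ}
    (hA : IsInvariantArray S A) :
    IsInvariantArray S fun I : Fin r → κ =>
      ∑ a, A (Matrix.vecCons a (Matrix.vecCons a I)) where
  perm σ hσ I := by
    rw [← Equiv.sum_comp σ]
    refine Finset.sum_congr rfl fun a _ => ?_
    refine (congrArg A ?_).trans (hA.perm σ hσ (Matrix.vecCons a (Matrix.vecCons a I)))
    funext k
    refine Fin.cases rfl (fun k => Fin.cases rfl (fun k => rfl) k) k
  sign ε hε I := by
    rw [Finset.mul_sum]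
    refine Finset.sum_congr rfl fun a _ => ?_
    have h := hA.sign ε hε (Matrix.vecCons a (Matrix.vecCons a I))
    rw [Fin.prod_univ_succ, Fin.prod_univ_succ] at h
    simp only [Matrix.cons_val_zero, Matrix.cons_val_succ] at h
    rwa [← mul_assoc, hε, one_mul] at h

variable {E : Type*} [NormedAddCommGroup E] [NormedSpace ℝ E]
  {M : Type*} [TopologicalSpace M] [ChartedSpace E M]

/-- The components of `T` in the coframe field `θ` form an invariant array, which is the same
at all points. -/
def HasInvariantComponents (S : Set (Equiv.Perm κ)) (θ : M → κ → E →ₗ[ℝ] ℂ) {r : ℕ}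
    (T : TensorField E M r) : Prop :=
  ∃ A : (Fin r → κ) → ℂ, IsInvariantArray S A ∧
    ∀ p v, (T p v : ℂ) = ∑ I, A I * ∏ k, θ p (I k) (v k)

variable {θ : M → κ → E →ₗ[ℝ] ℂ}

theorem HasInvariantComponents.zero {r : ℕ} :
    HasInvariantComponents S θ (0 : TensorField E M r) :=
  ⟨0, ⟨fun _ _ _ => rfl, fun _ _ _ => by simp⟩, fun p v => by simp⟩

theorem HasInvariantComponents.add {r : ℕ} {T U : TensorField E M r}
    (hT : HasInvariantComponents S θ T) (hU : HasInvariantComponents S θ U) :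
    HasInvariantComponents S θ (fun p v => T p v + U p v) := by
  obtain ⟨A, hA, hA'⟩ := hT
  obtain ⟨B, hB, hB'⟩ := hU
  refine ⟨fun I => A I + B I, ⟨fun σ hσ I => ?_, fun ε hε I => ?_⟩, fun p v => ?_⟩
  · simp only [hA.perm σ hσ, hB.perm σ hσ]
  · rw [mul_add, hA.sign ε hε, hB.sign ε hε]
  · push_cast
    simp only [hA', hB', add_mul, Finset.sum_add_distrib]

theorem HasInvariantComponents.smul {r : ℕ} (c : ℝ) {T : TensorField E M r}
    (hT : HasInvariantComponents S θ T) :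
    HasInvariantComponents S θ (fun p v => c * T p v) := by
  obtain ⟨A, hA, hA'⟩ := hT
  refine ⟨fun I => c * A I, ⟨fun σ hσ I => ?_, fun ε hε I => ?_⟩, fun p v => ?_⟩
  · simp only [hA.perm σ hσ]
  · rw [mul_left_comm, hA.sign ε hε]
  · push_cast
    simp only [hA', mul_assoc, Finset.mul_sum]

theorem HasInvariantComponents.tensor {r s : ℕ} {T : TensorField E M r} {U : TensorField E M s}
    (hT : HasInvariantComponents S θ T) (hU : HasInvariantComponents S θ U) :
    HasInvariantComponents S θ (r := r + s)
      (fun p v => T p (fun i => v (Fin.castAdd s i)) * U p (fun i => v (Fin.natAdd r i))) := by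
  obtain ⟨A, hA, hA'⟩ := hT
  obtain ⟨B, hB, hB'⟩ := hU
  refine ⟨fun I => A (fun i => I (Fin.castAdd s i)) * B (fun i => I (Fin.natAdd r i)),
    ⟨fun σ hσ I => ?_, fun ε hε I => ?_⟩, fun p v => ?_⟩
  · simp only [hA.perm σ hσ fun i => I (Fin.castAdd s i),
      hB.perm σ hσ fun i => I (Fin.natAdd r i)]
  · rw [Fin.prod_univ_add, mul_mul_mul_comm, hA.sign ε hε fun i => I (Fin.castAdd s i),
      hB.sign ε hε fun i => I (Fin.natAdd r i)]
  · push_cast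
    rw [hA', hB', Finset.sum_mul_sum, ← (Fin.appendEquiv r s).sum_comp, Fintype.sum_prod_type]
    refine Finset.sum_congr rfl fun I _ => Finset.sum_congr rfl fun J _ => ?_
    simp [Fin.prod_univ_add, Fin.appendEquiv]
    ring

theorem HasInvariantComponents.perm {r : ℕ} (τ : Equiv.Perm (Fin r)) {T : TensorField E M r}
    (hT : HasInvariantComponents S θ T) :
    HasInvariantComponents S θ (fun p v => T p (fun i => v (τ i))) := by
  obtain ⟨A, hA, hA'⟩ := hT
  refine ⟨fun I => A (fun i => I (τ i)), ⟨fun σ hσ I => ?_, fun ε hε I => ?_⟩, fun p v => ?_⟩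
  · exact hA.perm σ hσ fun i => I (τ i)
  · rw [← Equiv.prod_comp τ fun k => ε (I k)]
    exact hA.sign ε hε fun i => I (τ i)
  · rw [hA']
    refine Fintype.sum_equiv (Equiv.arrowCongr τ (Equiv.refl κ)) _ _ fun I => ?_
    rw [← Equiv.prod_comp τ fun k => θ p (Equiv.arrowCongr τ (Equiv.refl κ) I k) (v k)]
    simp [Equiv.arrowCongr]

variable [FiniteDimensional ℝ E] {g : MetricField E M}

theorem HasInvariantComponents.metric (hθ : ∀ p, IsCoframe (fun v w => g p v w) (θ p)) :
    HasInvariantComponents S θ (metricTensor g) := by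
  classical
  refine ⟨fun I => if I 0 = I 1 then 1 else 0, ⟨fun σ hσ I => ?_, fun ε hε I => ?_⟩,
    fun p v => ?_⟩
  · simp
  · by_cases h : I 0 = I 1
    · simp [Fin.prod_univ_two, h, hε]
    · simp [h]
  · rw [metricTensor, hθ p, sum_vecCons]
    refine Finset.sum_congr rfl fun a _ => ?_
    rw [sum_vecCons]
    simp [Fin.prod_univ_two]

/-- The coframe is orthonormal for the inverse metric, so contraction sums over a repeated index of
the array, with no dependence on the point. -/
theorem HasInvariantComponents.contract (hg : IsPseudoRiemannian g)
    (hθ : ∀ p, IsCoframe (fun v w => g p v w) (θ p))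
    (hκ : Fintype.card κ = Module.finrank ℝ E) {r : ℕ} {T : TensorField E M (r + 2)}
    (hT : HasInvariantComponents S θ T) :
    HasInvariantComponents S θ (PseudoRiem.contract g T) := by
  classical
  obtain ⟨A, hA, hA'⟩ := hT
  refine ⟨_, hA.contract, fun p v => ?_⟩
  have key := (hθ p).sum_inverseForm (hg.nondegenerate p) hκ
  have h1 : ∀ x y : E, (T p (Matrix.vecCons x (Matrix.vecCons y v)) : ℂ) =
      ∑ a, ∑ b, (θ p a x * θ p b y) * ∑ I : Fin r → κ,
        A (Matrix.vecCons a (Matrix.vecCons b I)) * ∏ k, θ p (I k) (v k) := by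
    intro x y
    rw [hA', sum_vecCons]
    refine Finset.sum_congr rfl fun a _ => ?_
    rw [sum_vecCons]
    refine Finset.sum_congr rfl fun b _ => ?_
    rw [Finset.mul_sum]
    refine Finset.sum_congr rfl fun I _ => ?_
    rw [Fin.prod_univ_succ, Fin.prod_univ_succ]
    simp only [Matrix.cons_val_zero, Matrix.cons_val_succ]
    ring
  set C : κ → κ → ℂ := fun a b => ∑ I : Fin r → κ,
    A (Matrix.vecCons a (Matrix.vecCons b I)) * ∏ k, θ p (I k) (v k) with hC
  have h2 : (PseudoRiem.contract g T p v : ℂ) = ∑ a, ∑ b,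
      (∑ i, ∑ j, (inverseForm (fun v w => g p v w) i j : ℂ) *
        (θ p a (frame E i) * θ p b (frame E j))) * C a b := by
    simp only [PseudoRiem.contract, inverseMetric]
    push_cast
    simp only [h1, Finset.mul_sum (s := (Finset.univ : Finset κ))]
    rw [sum_comm_pairs]
    simp only [Finset.sum_mul, mul_assoc]
    rfl
  rw [h2]
  simp only [key, ite_mul, one_mul, zero_mul, Finset.sum_ite_eq, Finset.mem_univ, if_true, hC,
    Finset.sum_mul]
  exact Finset.sum_comm

theorem IsCurvaturePolynomial.hasInvariantComponents (hg : IsPseudoRiemannian g)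
    (hθ : ∀ p, IsCoframe (fun v w => g p v w) (θ p))
    (hκ : Fintype.card κ = Module.finrank ℝ E)
    (hR : ∀ j, HasInvariantComponents S θ (PseudoRiem.nablaRiemann g j)) {k r : ℕ}
    {T : TensorField E M r} (hT : IsCurvaturePolynomial g k r T) :
    HasInvariantComponents S θ T := by
  induction hT with
  | metric => exact HasInvariantComponents.metric hθ
  | nablaRiemann j _ => exact hR j
  | add _ _ h1 h2 => exact h1.add h2
  | smul c _ h => exact h.smul c
  | tensor _ _ h1 h2 => exact h1.tensor h2
  | perm σ _ h => exact h.perm σ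
  | contract _ h => exact h.contract hg hθ hκ

/-- Flipping the sign of one coframe element kills the off-diagonal components; transitivity of `S`
makes the diagonal ones equal. -/
theorem HasInvariantComponents.eq_const_mul (hθ : ∀ p, IsCoframe (fun v w => g p v w) (θ p))
    (hS : ∀ a b, ∃ σ ∈ S, σ a = b) {T : TensorField E M 2}
    (hT : HasInvariantComponents S θ T) :
    ∃ c : ℝ, ∀ (p : M) (v w : E), T p ![v, w] = c * g p v w := by
  classical
  obtain ⟨A, hA, hA'⟩ := hT
  have hoff : ∀ a b, a ≠ b → A ![a, b] = 0 := by
    intro a b hab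
    have h := hA.sign (fun c => if c = a then -1 else 1) (fun c => by split_ifs <;> simp) ![a, b]
    simp only [Fin.prod_univ_two, Matrix.cons_val_zero, Matrix.cons_val_one, if_true,
      hab.symm, if_false] at h
    linear_combination (-1 / 2 : ℂ) * h
  obtain ⟨c, hc⟩ : ∃ c : ℂ, ∀ a, A ![a, a] = c := by
    rcases isEmpty_or_nonempty κ with h | ⟨⟨a₀⟩⟩
    · exact ⟨0, fun a => h.elim a⟩
    · refine ⟨A ![a₀, a₀], fun a => ?_⟩
      obtain ⟨σ, hσ, rfl⟩ := hS a₀ a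
      refine (congrArg A ?_).trans (hA.perm σ hσ ![a₀, a₀])
      funext k
      fin_cases k <;> rfl
  have key : ∀ (p : M) (v w : E), (T p ![v, w] : ℂ) = c * (g p v w : ℂ) := by
    intro p v w
    rw [show (g p v w : ℂ) = _ from hθ p v w, hA', sum_vec_two, Finset.mul_sum]
    refine Finset.sum_congr rfl fun a _ => ?_
    rw [Finset.sum_eq_single a]
    · simp [Fin.prod_univ_two, hc a]
    · intro b _ hb
      rw [hoff a b hb.symm, zero_mul]
    · simp
  -- Both `T` and `g` are real, so the real part of the complex factor serves as well.
  refine ⟨c.re, fun p v w => ?_⟩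
  have := congrArg Complex.re (key p v w)
  simpa using this

end InvariantArray

/-! ### Universality for equal dimensions and curvatures. -/

section Universal

set_option linter.unusedSectionVars false

variable {ι : Type*} [Fintype ι] {E : ι → Type*} [∀ α, NormedAddCommGroup (E α)]
  [∀ α, NormedSpace ℝ (E α)] {M : ι → Type*} [∀ α, TopologicalSpace (M α)]
  [∀ α, ChartedSpace (E α) (M α)] [∀ α, FiniteDimensional ℝ (E α)]
  [∀ α, IsManifold 𝓘(ℝ, E α) ∞ (M α)]

/-- The array is `δ_{IJ} δ_{KL}` times the indicator that `I` and `K` lie in the same block.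
Permuting blocks, and indices alike within all blocks, respects both conditions. The Riemann tensor
is built from this tensor by permuting indices. -/
theorem hasInvariantComponents_sum_block_mul_block {m : ℕ} {g : ∀ α, MetricField (E α) (M α)}
    {θ : ∀ α, M α → Fin m → E α →ₗ[ℝ] ℂ}
    (hθ : ∀ α p, IsCoframe (fun v w => g α p v w) (θ α p)) :
    HasInvariantComponents
      (Set.range fun στ : Equiv.Perm ι × Equiv.Perm (Fin m) => στ.1.prodCongr στ.2)
      (fun (p : ∀ α, M α) I => (θ I.1 (p I.1) I.2).comp (LinearMap.proj (φ := E) I.1))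
      (r := 4) (fun p v => ∑ α, g α (p α) (v 0 α) (v 1 α) * g α (p α) (v 2 α) (v 3 α)) := by
  classical
  refine ⟨fun I => (if I 0 = I 1 then 1 else 0) *
    ((if I 2 = I 3 then 1 else 0) * (if (I 0).1 = (I 2).1 then 1 else 0)),
    ⟨?_, fun ε hε I => ?_⟩, fun p v => ?_⟩
  · rintro _ ⟨⟨σ, τ⟩, rfl⟩ I
    simp only [Equiv.apply_eq_iff_eq]
    simp
  · by_cases h1 : I 0 = I 1
    · by_cases h2 : I 2 = I 3
      · rw [Fin.prod_univ_four, h1, h2, hε, one_mul, hε, one_mul]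
      · simp [h2]
    · simp [h1]
  · rw [sum_vec_four, Fintype.sum_prod_type]
    push_cast
    refine Finset.sum_congr rfl fun α _ => ?_
    rw [show (g α (p α) (v 0 α) (v 1 α) : ℂ) = _ from hθ α (p α) _ _,
      show (g α (p α) (v 2 α) (v 3 α) : ℂ) = _ from hθ α (p α) _ _, Finset.sum_mul_sum]
    refine Finset.sum_congr rfl fun i _ => ?_
    rw [Finset.sum_eq_single (α, i) (fun b _ hb => by simp [hb.symm]) (by simp),
      Fintype.sum_prod_type, Finset.sum_eq_single α (fun β _ hβ => by simp [hβ.symm]) (by simp)]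
    refine Finset.sum_congr rfl fun j _ => ?_
    rw [Finset.sum_eq_single (α, j) (fun b _ hb => by simp [hb.symm]) (by simp),
      Fin.prod_univ_four]
    simp only [Matrix.cons_val, if_true, one_mul]
    exact (mul_assoc _ _ _).symm

theorem isUniversal_productMetric {m : ℕ} {g : ∀ α, MetricField (E α) (M α)}
    (hg : ∀ α, IsPseudoRiemannian (g α)) {K : ℝ}
    (hK : ∀ α (p : M α) (a b c d : E α), riemann (g α) p ![a, b, c, d] =
      K * (g α p a c * g α p b d - g α p a d * g α p b c))
    (hm : ∀ α, Module.finrank ℝ (E α) = m) : IsUniversal (productMetric g) := by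
  classical
  have hex := fun α p => exists_isCoframe (g α p) ((hg α).symm p) (hm α)
  choose θ hθ using hex
  let Θ : (∀ α, M α) → ι × Fin m → (∀ α, E α) →ₗ[ℝ] ℂ :=
    fun p I => (θ I.1 (p I.1) I.2).comp (LinearMap.proj (φ := E) I.1)
  let S : Set (Equiv.Perm (ι × Fin m)) :=
    Set.range fun στ : Equiv.Perm ι × Equiv.Perm (Fin m) => στ.1.prodCongr στ.2
  have hΘ : ∀ p, IsCoframe (fun v w => productMetric g p v w) (Θ p) := by
    intro p v w
    simp only [Fintype.sum_prod_type, productMetric_apply]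
    push_cast
    exact Finset.sum_congr rfl fun β _ => hθ β (p β) (v β) (w β)
  have hcard : Fintype.card (ι × Fin m) = Module.finrank ℝ (∀ α, E α) := by
    simp [Module.finrank_pi_fintype, hm]
  have hX := hasInvariantComponents_sum_block_mul_block hθ
  have hR : ∀ j, HasInvariantComponents S Θ (nablaRiemann (productMetric g) j) := by
    intro j
    cases j with
    | zero =>
      change HasInvariantComponents S Θ (riemann (productMetric g))
      rw [riemann_productMetric_of_constant (K := fun _ => K) hg hK]
      -- With `X = ∑ g_α ⊗ g_α`, the Riemann tensor is `K (X_{acbd} - X_{adbc})`.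
      have h := ((hX.perm (Equiv.swap 1 2)).smul K).add
        (((hX.perm (Equiv.swap 1 2)).perm (Equiv.swap 2 3)).smul (-K))
      convert h using 1
      funext p v
      rw [blockRiemann, Finset.mul_sum, Finset.mul_sum, ← Finset.sum_add_distrib]
      refine Finset.sum_congr rfl fun α _ => ?_
      have e1 : (Equiv.swap (1 : Fin 4) 2) 0 = 0 := by decide
      have e2 : (Equiv.swap (1 : Fin 4) 2) 3 = 3 := by decide
      have e3 : (Equiv.swap (2 : Fin 4) 3) 0 = 0 := by decide
      have e4 : (Equiv.swap (2 : Fin 4) 3) 1 = 1 := by decide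
      simp only [e1, e2, e3, e4, Equiv.swap_apply_left, Equiv.swap_apply_right, blockMetric,
        Matrix.cons_val_zero, Matrix.cons_val_one]
      ring
    | succ j =>
      rw [nablaRiemann_succ_productMetric (K := fun _ => K) hg hK]
      exact HasInvariantComponents.zero
  intro k T hT _ _
  refine (hT.hasInvariantComponents (IsPseudoRiemannian.productMetric hg) hΘ hcard
    hR).eq_const_mul hΘ ?_
  rintro ⟨a, i⟩ ⟨b, j⟩
  exact ⟨_, ⟨(Equiv.swap a b, Equiv.swap i j), rfl⟩, by simp⟩

end Universal

/-! ### Two curvature polynomials of rank two. -/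

section Quadratic

variable {E : Type*} [NormedAddCommGroup E] [NormedSpace ℝ E] [FiniteDimensional ℝ E]
  {M : Type*} [TopologicalSpace M] [ChartedSpace E M]

theorem isCurvaturePolynomial_ricci (g : MetricField E M) (k : ℕ) :
    IsCurvaturePolynomial g k 2 (ricci g) := by
  have h : IsCurvaturePolynomial g k 4 (riemann g) := .nablaRiemann 0 (Nat.zero_le k)
  convert (h.perm (Equiv.swap 1 2)).contract (r := 2) using 1
  funext p v
  rw [ricci_eq_metricTrace, contract_eq_metricTrace]
  congr 1

/-- The contraction `R_{acde} R_b^{cde}`. -/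
def riemannSquare (g : MetricField E M) : TensorField E M 2 := fun p v =>
  metricTrace g p fun c c' => metricTrace g p fun d d' => metricTrace g p fun e e' =>
    riemann g p ![v 0, c, d, e] * riemann g p ![v 1, c', d', e']

theorem isCurvaturePolynomial_riemannSquare (g : MetricField E M) (k : ℕ) :
    IsCurvaturePolynomial g k 2 (riemannSquare g) := by
  have h : IsCurvaturePolynomial g k 4 (riemann g) := .nablaRiemann 0 (Nat.zero_le k)
  -- After three contractions of leading pairs, the slots are ordered `e, e', d, d', c, c', v 0, v
  -- 1`. The first list sends them to `R(v 0, c, d, e) R(v 1, c', d', e')`; the second is its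
  -- inverse.
  let σ : Equiv.Perm (Fin (4 + 4)) :=
    ⟨![6, 4, 2, 0, 7, 5, 3, 1], ![3, 7, 2, 6, 1, 5, 0, 4], by decide, by decide⟩
  have h8 : IsCurvaturePolynomial g k (6 + 2) _ := (h.tensor h).perm σ
  have h4 : IsCurvaturePolynomial g k (2 + 2) _ := IsCurvaturePolynomial.contract (r := 4)
    (IsCurvaturePolynomial.contract (r := 6) h8)
  convert h4.contract using 1
  funext p v
  simp only [riemannSquare, contract_eq_metricTrace]
  congr 1

end Quadratic

/-! ### Contractions of the product curvature, and necessity of equal factors. -/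

section ProductTraces

set_option linter.unusedSectionVars false

variable {ι : Type*} [Fintype ι] {E : ι → Type*} [∀ α, NormedAddCommGroup (E α)]
  [∀ α, NormedSpace ℝ (E α)] {M : ι → Type*} [∀ α, TopologicalSpace (M α)]
  [∀ α, ChartedSpace (E α) (M α)] [∀ α, FiniteDimensional ℝ (E α)]
  [∀ α, IsManifold 𝓘(ℝ, E α) ∞ (M α)] {g : ∀ α, MetricField (E α) (M α)}

theorem metricTrace_block_mul_block_self (hg : ∀ α, IsPseudoRiemannian (g α)) (p : ∀ α, M α)
    (α : ι) (v w : E α) :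
    metricTrace (productMetric g) p (fun a b => g α (p α) v (a α) * g α (p α) w (b α)) =
      g α (p α) v w := by
  classical
  simpa using metricTrace_block_mul_block hg p α α v w

theorem metricTrace_sum_block_mul_sum_block (hg : ∀ α, IsPseudoRiemannian (g α))
    (p : ∀ α, M α) (v w : ∀ α, E α) :
    metricTrace (productMetric g) p (fun a b =>
      (∑ α, g α (p α) (v α) (a α)) * ∑ β, g β (p β) (w β) (b β)) =
      ∑ α, g α (p α) (v α) (w α) := by
  classical
  simp only [Finset.sum_mul_sum, metricTrace_sum, metricTrace_block_mul_block hg p]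
  refine Finset.sum_congr rfl fun α _ => ?_
  rw [Finset.sum_eq_single α]
  · simp
  · intro β _ hβ
    simp [Pi.single_eq_of_ne hβ.symm]
  · simp

theorem blockRiemann_apply (K : ι → ℝ) (p : ∀ α, M α) (a b c d : ∀ α, E α) :
    blockRiemann g K p ![a, b, c, d] = ∑ α, K α *
      (g α (p α) (a α) (c α) * g α (p α) (b α) (d α) -
        g α (p α) (a α) (d α) * g α (p α) (b α) (c α)) := by
  simp [blockRiemann, blockMetric]

variable {K : ι → ℝ}

theorem ricci_productMetric (hg : ∀ α, IsPseudoRiemannian (g α))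
    (hK : ∀ α (p : M α) (a b c d : E α), riemann (g α) p ![a, b, c, d] =
      K α * (g α p a c * g α p b d - g α p a d * g α p b c)) (p : ∀ α, M α)
    (v : Fin 2 → ∀ α, E α) :
    ricci (productMetric g) p v =
      ∑ α, ((Module.finrank ℝ (E α) - 1) * K α) * g α (p α) (v 0 α) (v 1 α) := by
  classical
  rw [ricci_eq_metricTrace, riemann_productMetric_of_constant hg hK]
  simp only [blockRiemann_apply, metricTrace_sum, metricTrace_const_mul, metricTrace_sub]
  refine Finset.sum_congr rfl fun α _ => ?_
  have h1 : metricTrace (productMetric g) p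
      (fun a b => g α (p α) (a α) (b α) * g α (p α) (v 0 α) (v 1 α)) =
      Module.finrank ℝ (E α) * g α (p α) (v 0 α) (v 1 α) := by
    simp only [mul_comm _ (g α (p α) (v 0 α) (v 1 α)), metricTrace_const_mul,
      metricTrace_block hg]
  have h2 : metricTrace (productMetric g) p
      (fun a b => g α (p α) (a α) (v 1 α) * g α (p α) (v 0 α) (b α)) =
      g α (p α) (v 0 α) (v 1 α) := by
    simp only [(hg α).symm (p α) _ (v 1 α)]
    rw [metricTrace_block_mul_block_self hg]
  rw [h1, h2]
  ring

theorem riemannSquare_productMetric (hg : ∀ α, IsPseudoRiemannian (g α))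
    (hK : ∀ α (p : M α) (a b c d : E α), riemann (g α) p ![a, b, c, d] =
      K α * (g α p a c * g α p b d - g α p a d * g α p b c)) (p : ∀ α, M α)
    (v : Fin 2 → ∀ α, E α) :
    riemannSquare (productMetric g) p v =
      ∑ α, (2 * (Module.finrank ℝ (E α) - 1) * K α ^ 2) * g α (p α) (v 0 α) (v 1 α) := by
  classical
  have hs := fun α (x y : E α) => (hg α).symm (p α) x y
  -- Writing the last slot as a pairing with a fixed vector in each block lets the trace over that
  -- slot be evaluated at once.
  have hlin : ∀ a c d e : ∀ α, E α, riemann (productMetric g) p ![a, c, d, e] =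
      ∑ α, g α (p α) (K α • (g α (p α) (a α) (d α) • c α - g α (p α) (c α) (d α) • a α))
        (e α) := by
    intro a c d e
    rw [riemann_productMetric_of_constant hg hK, blockRiemann_apply]
    refine Finset.sum_congr rfl fun α _ => ?_
    simp only [map_smul, map_sub, smul_apply, sub_apply, smul_eq_mul]
    ring
  have h1 : ∀ c c' d d' : ∀ α, E α, metricTrace (productMetric g) p (fun e e' =>
      riemann (productMetric g) p ![v 0, c, d, e] *
        riemann (productMetric g) p ![v 1, c', d', e']) =
      ∑ α, K α ^ 2 * (
        g α (p α) (c α) (c' α) * (g α (p α) (v 0 α) (d α) * g α (p α) (v 1 α) (d' α)) -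
        g α (p α) (c α) (v 1 α) * (g α (p α) (v 0 α) (d α) * g α (p α) (c' α) (d' α)) -
        g α (p α) (v 0 α) (c' α) * (g α (p α) (c α) (d α) * g α (p α) (v 1 α) (d' α)) +
        g α (p α) (v 0 α) (v 1 α) * (g α (p α) (c α) (d α) * g α (p α) (c' α) (d' α))) := by
    intro c c' d d'
    simp only [hlin]
    rw [metricTrace_sum_block_mul_sum_block hg p
      (fun α => K α • (g α (p α) (v 0 α) (d α) • c α - g α (p α) (c α) (d α) • v 0 α))
      (fun α => K α • (g α (p α) (v 1 α) (d' α) • c' α - g α (p α) (c' α) (d' α) • v 1 α))]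
    refine Finset.sum_congr rfl fun α _ => ?_
    simp only [map_smul, map_sub, smul_apply, sub_apply, smul_eq_mul]
    ring
  simp only [riemannSquare, h1, metricTrace_sum, metricTrace_const_mul, metricTrace_sub,
    metricTrace_add, metricTrace_block_mul_block_self hg]
  refine Finset.sum_congr rfl fun α _ => ?_
  have h2 : metricTrace (productMetric g) p
      (fun a b => g α (p α) (a α) (b α) * g α (p α) (v 0 α) (v 1 α)) =
      Module.finrank ℝ (E α) * g α (p α) (v 0 α) (v 1 α) := by
    simp only [mul_comm _ (g α (p α) (v 0 α) (v 1 α)), metricTrace_const_mul,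
      metricTrace_block hg]
  have h3 : metricTrace (productMetric g) p
      (fun a b => g α (p α) (a α) (v 1 α) * g α (p α) (v 0 α) (b α)) =
      g α (p α) (v 0 α) (v 1 α) := by
    simp only [hs α _ (v 1 α)]
    rw [metricTrace_block_mul_block_self hg, hs]
  have h4 : metricTrace (productMetric g) p
      (fun a b => g α (p α) (v 0 α) (b α) * g α (p α) (a α) (v 1 α)) =
      g α (p α) (v 0 α) (v 1 α) := by
    rw [← h3]
    congr 1
    funext a b
    ring
  rw [h2, h3, h4, metricTrace_block hg]
  ring

theorem isConserved_of_eq_sum_block (hg : ∀ α, IsPseudoRiemannian (g α))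
    {T : TensorField (∀ α, E α) (∀ α, M α) 2} {c : ι → ℝ}
    (hT : ∀ p v, T p v = ∑ α, c α * g α (p α) (v 0 α) (v 1 α)) :
    IsConserved (productMetric g) T := by
  intro p v
  have h : T = fun p v => ∑ α, c α * blockMetric g α p v := by
    funext p v
    exact hT p v
  rw [h, covDeriv_sum_blockMetric hg]
  simp [contract]

/-- Such a `T` is symmetric and conserved, so it is a multiple `C` of the metric; testing on vectors
supported in one block gives `c γ = C`. -/
theorem IsUniversal.eq_of_eq_sum_block (hg : ∀ α, IsPseudoRiemannian (g α))
    (hU : IsUniversal (productMetric g)) [∀ α, Nonempty (M α)] [∀ α, Nontrivial (E α)]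
    {T : TensorField (∀ α, E α) (∀ α, M α) 2}
    (hpoly : IsCurvaturePolynomial (productMetric g) 0 2 T) {c : ι → ℝ}
    (hT : ∀ p v, T p v = ∑ α, c α * g α (p α) (v 0 α) (v 1 α)) (α β : ι) : c α = c β := by
  classical
  obtain ⟨C, hC⟩ := hU 0 T hpoly
    (fun p v w => by simp only [hT, Matrix.cons_val_zero, Matrix.cons_val_one,
      (hg _).symm _ (v _)])
    (isConserved_of_eq_sum_block hg hT)
  have key : ∀ γ, c γ = C := by
    intro γ
    have p : ∀ α, M α := fun α => Classical.arbitrary _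
    obtain ⟨v, hv⟩ := exists_ne (0 : E γ)
    obtain ⟨w, hw⟩ : ∃ w, g γ (p γ) v w ≠ 0 := by
      by_contra! h
      exact hv ((hg γ).nondegenerate (p γ) v h)
    have h := hC p (Pi.single γ v) (Pi.single γ w)
    rw [hT, productMetric_apply, Finset.sum_eq_single γ, Finset.sum_eq_single γ] at h
    · simpa [hw] using h
    · intro δ _ hδ
      simp [Pi.single_eq_of_ne hδ]
    · simp
    · intro δ _ hδ
      simp [Pi.single_eq_of_ne hδ]
    · simp
  rw [key, key]

/-- In dimension at most one the antisymmetrized product of metrics vanishes, and an empty manifold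
is vacuously flat. -/
theorem two_le_finrank_of_not_isFlat {E : Type*} [NormedAddCommGroup E] [NormedSpace ℝ E]
    [FiniteDimensional ℝ E] {M : Type*} [TopologicalSpace M] [ChartedSpace E M]
    {g : MetricField E M} {K : ℝ}
    (hK : ∀ (p : M) (a b c d : E), riemann g p ![a, b, c, d] =
      K * (g p a c * g p b d - g p a d * g p b c)) (hflat : ¬ IsFlat g) :
    2 ≤ Module.finrank ℝ E ∧ K ≠ 0 ∧ Nonempty M := by
  have h4 : ∀ v : Fin 4 → E, v = ![v 0, v 1, v 2, v 3] := fun v => by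
    funext i; fin_cases i <;> rfl
  refine ⟨?_, ?_, ?_⟩
  · by_contra! h
    obtain ⟨e, he⟩ := finrank_le_one_iff.1 (Nat.le_of_lt_succ h)
    refine hflat fun p v => ?_
    rw [h4 v, hK]
    obtain ⟨a, ha⟩ := he (v 0)
    obtain ⟨b, hb⟩ := he (v 1)
    rw [← ha, ← hb]
    simp only [map_smul, smul_apply, smul_eq_mul]
    ring
  · rintro rfl
    exact hflat fun p v => by rw [h4 v, hK, zero_mul]
  · by_contra h
    exact hflat fun p => (h ⟨p⟩).elim

/-- A product of non-flat spaces of constant curvature is universal if and only if the dimensions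
and the curvatures of the factors agree. -/
theorem isUniversal_productMetric_iff (hg : ∀ α, IsPseudoRiemannian (g α))
    (hK : ∀ α (p : M α) (a b c d : E α), riemann (g α) p ![a, b, c, d] =
      K α * (g α p a c * g α p b d - g α p a d * g α p b c))
    (hflat : ∀ α, ¬ IsFlat (g α)) (α₀ : ι) :
    IsUniversal (productMetric g) ↔
      ∀ α, Module.finrank ℝ (E α) = Module.finrank ℝ (E α₀) ∧ K α = K α₀ := by
  have hnf := fun α => two_le_finrank_of_not_isFlat (hK α) (hflat α)
  constructor
  · intro hU α
    have : ∀ α, Nonempty (M α) := fun α => (hnf α).2.2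
    have : ∀ α, Nontrivial (E α) := fun α =>
      Module.nontrivial_of_finrank_pos (R := ℝ) (by have := (hnf α).1; omega)
    have h1 := IsUniversal.eq_of_eq_sum_block hg hU (isCurvaturePolynomial_ricci _ 0)
      (ricci_productMetric hg hK) α α₀
    have h2 := IsUniversal.eq_of_eq_sum_block hg hU (isCurvaturePolynomial_riemannSquare _ 0)
      (riemannSquare_productMetric hg hK) α α₀
    have hn : ((2 : ℕ) : ℝ) ≤ Module.finrank ℝ (E α) := Nat.cast_le.2 (hnf α).1
    have hpos : ((Module.finrank ℝ (E α) : ℝ) - 1) * K α ≠ 0 :=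
      mul_ne_zero (by push_cast at hn; linarith) (hnf α).2.1
    -- The quadratic relation minus `K α₀` times the Ricci relation leaves `(n α - 1) K α (K α - K
    -- α₀) = 0`.
    have hKK : K α = K α₀ :=
      mul_left_cancel₀ hpos (by linear_combination h2 / 2 - K α₀ * h1)
    refine ⟨?_, hKK⟩
    rw [hKK] at h1
    have := mul_right_cancel₀ (hnf α₀).2.1 h1
    have h3 : (Module.finrank ℝ (E α) : ℝ) = Module.finrank ℝ (E α₀) := by linarith
    exact_mod_cast h3
  · intro h
    refine isUniversal_productMetric hg (K := K α₀) (fun α p a b c d => ?_) fun α => (h α).1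
    rw [hK, (h α).2]

end ProductTraces

/-! ### The metric `dt² + exp (2 t) h` has curvature `-1`. -/

section Warped

set_option linter.unusedSectionVars false

variable {E : Type*} [NormedAddCommGroup E] [NormedSpace ℝ E]

theorem chartPush_model (x y : E) : chartPush E x y = ContinuousLinearMap.id ℝ E := by
  have h : (chartAt E x).symm = OpenPartialHomeomorph.refl E := rfl
  rw [chartPush, h]
  exact mfderiv_id

theorem metricInChart_model (g : MetricField E E) (x y v w : E) :
    metricInChart g x y v w = g y v w := by
  rw [metricInChart_eq, chartForm, chartPush_model]
  rfl

/-- The metric `ℓ ⊗ ℓ + exp (2 ℓ) h` on a vector space. -/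
def warpedMetric (l : E →L[ℝ] ℝ) (h : E →L[ℝ] E →L[ℝ] ℝ) : MetricField E E :=
  fun y => l.smulRight l + Real.exp (2 * l y) • h

variable {l : E →L[ℝ] ℝ} {h : E →L[ℝ] E →L[ℝ] ℝ}

theorem warpedMetric_apply (y v w : E) :
    warpedMetric l h y v w = l v * l w + Real.exp (2 * l y) * h v w := by
  simp [warpedMetric]

theorem isPseudoRiemannian_warpedMetric {e : E} (he : l e = 1) (hsymm : ∀ v w, h v w = h w v)
    (hhe : ∀ v, h v e = 0) (hnd : ∀ v, l v = 0 → (∀ w, h v w = 0) → v = 0) :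
    IsPseudoRiemannian (warpedMetric l h) where
  symm p v w := by
    rw [warpedMetric_apply, warpedMetric_apply, hsymm, mul_comm (l v)]
  nondegenerate p v hv := by
    have hl : l v = 0 := by
      have := hv e
      rwa [warpedMetric_apply, hhe, he, mul_one, mul_zero, add_zero] at this
    refine hnd v hl fun w => ?_
    have := hv w
    rw [warpedMetric_apply, hl, zero_mul, zero_add] at this
    exact (mul_eq_zero.1 this).resolve_left (Real.exp_pos _).ne'
  smooth x v w := by
    simp only [metricInChart_model, warpedMetric_apply]
    fun_prop

/-- The constant `b` stands for the term `l v * l w` of the metric, which does not vary. -/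
theorem fderiv_exp_mul (l : E →L[ℝ] ℝ) (y u : E) (k : ℝ) (b : ℝ) :
    fderiv ℝ (fun z => b + Real.exp (2 * l z) * k) y u =
      2 * l u * Real.exp (2 * l y) * k := by
  have h1 : HasFDerivAt (fun z => 2 * l z) ((2 : ℝ) • l) y := l.hasFDerivAt.const_mul 2
  have h2 := (h1.exp.mul_const k).const_add b
  rw [h2.fderiv]
  simp
  ring

variable [FiniteDimensional ℝ E]

/-- Here `e` is the unit vector `∂_t` orthogonal to the slices; the formula is checked by lowering
the index. -/
theorem christoffel_warpedMetric {e : E} (he : l e = 1) (hsymm : ∀ v w, h v w = h w v)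
    (hhe : ∀ v, h v e = 0) (hnd : ∀ v, l v = 0 → (∀ w, h v w = 0) → v = 0) (x y u v : E) :
    christoffel (warpedMetric l h) x y u v =
      l u • v + l v • u - (2 * l u * l v + Real.exp (2 * l y) * h u v) • e := by
  refine (isPseudoRiemannian_warpedMetric he hsymm hhe hnd).christoffel_eq x (Set.mem_univ _)
    fun w => ?_
  have hew : h e w = 0 := by rw [hsymm, hhe]
  simp only [metricInChart_model, christoffelFirst, warpedMetric_apply, fderiv_exp_mul l,
    map_sub, map_add, map_smul, sub_apply, add_apply, smul_apply, smul_eq_mul, he, hew]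
  ring

theorem riemann_warpedMetric {e : E} (he : l e = 1) (hsymm : ∀ v w, h v w = h w v)
    (hhe : ∀ v, h v e = 0) (hnd : ∀ v, l v = 0 → (∀ w, h v w = 0) → v = 0) (p a b c d : E) :
    riemann (warpedMetric l h) p ![a, b, c, d] =
      (-1) * (warpedMetric l h p a c * warpedMetric l h p b d -
        warpedMetric l h p a d * warpedMetric l h p b c) := by
  have hew : ∀ w, h e w = 0 := fun w => by rw [hsymm, hhe]
  have hfd : ∀ (A : E) (k b : ℝ) (y u : E),
      fderiv ℝ (fun z => A - (b + Real.exp (2 * l z) * k) • e) y u =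
        -(2 * l u * Real.exp (2 * l y) * k) • e := by
    intro A k b y u
    have hd : DifferentiableAt ℝ (fun z => b + Real.exp (2 * l z) * k) y := by fun_prop
    rw [fderiv_const_sub, fderiv_smul_const hd]
    simp only [neg_apply, ContinuousLinearMap.smulRight_apply, fderiv_exp_mul l, neg_smul]
  simp only [riemann, curvature, christoffel_warpedMetric he hsymm hhe hnd, hfd,
    Matrix.cons_val]
  simp only [warpedMetric_apply, chartAt_self_eq, OpenPartialHomeomorph.refl_apply, id_eq, map_sub,
    map_add, map_smul, sub_apply, add_apply, smul_apply, smul_eq_mul, he, hew, hhe, map_neg,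
    neg_apply, neg_smul]
  rw [hsymm b a]
  ring

end Warped

/-! ### Signature and Weyl tensor of the product. -/

section Lorentzian

set_option linter.unusedSectionVars false

variable {ι : Type*} [Fintype ι] {E : ι → Type*} [∀ α, NormedAddCommGroup (E α)]
  [∀ α, NormedSpace ℝ (E α)] {M : ι → Type*} [∀ α, TopologicalSpace (M α)]
  [∀ α, ChartedSpace (E α) (M α)] {g : ∀ α, MetricField (E α) (M α)}

theorem productMetric_single [DecidableEq ι] (p : ∀ α, M α) (α : ι) (v : E α) (w : ∀ α, E α) :
    productMetric g p (Pi.single α v) w = g α (p α) v (w α) := by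
  rw [productMetric_apply, Finset.sum_eq_single α]
  · simp
  · intro β _ hβ
    simp [Pi.single_eq_of_ne hβ]
  · simp

theorem isLorentzian_productMetric {α : ι} (hα : IsLorentzian (g α))
    (hpos : ∀ β, β ≠ α → ∀ p v, v ≠ 0 → 0 < g β p v v) : IsLorentzian (productMetric g) := by
  classical
  intro p
  obtain ⟨u, hu, huv⟩ := hα (p α)
  refine ⟨Pi.single α u, by simpa [productMetric_single] using hu, fun v hv hv0 => ?_⟩
  rw [productMetric_single] at hv
  have hterm : ∀ β, v β ≠ 0 → 0 < g β (p β) (v β) (v β) := by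
    intro β hβ
    by_cases h : β = α
    · subst h
      exact huv _ hv hβ
    · exact hpos β h _ _ hβ
  rw [productMetric_apply]
  obtain ⟨β, hβ⟩ := Function.ne_iff.1 hv0
  refine Finset.sum_pos' (fun γ _ => ?_) ⟨β, Finset.mem_univ _, hterm β hβ⟩
  by_cases h : v γ = 0
  · simp [h]
  · exact (hterm γ h).le

variable [∀ α, FiniteDimensional ℝ (E α)] [∀ α, IsManifold 𝓘(ℝ, E α) ∞ (M α)]

/-- Equal factors make the product Einstein, with Ricci tensor `(m - 1) K g`, so the trace terms
combine into one multiple of the constant curvature expression. -/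
theorem weyl_productMetric {m : ℕ} (hg : ∀ α, IsPseudoRiemannian (g α)) {K : ℝ}
    (hK : ∀ α (p : M α) (a b c d : E α), riemann (g α) p ![a, b, c, d] =
      K * (g α p a c * g α p b d - g α p a d * g α p b c))
    (hm : ∀ α, Module.finrank ℝ (E α) = m) (hd : 2 < Module.finrank ℝ (∀ α, E α))
    (p : ∀ α, M α) (a b c d : ∀ α, E α) :
    weyl (productMetric g) p a b c d = blockRiemann g (fun _ => K) p ![a, b, c, d] -
      (m - 1) * K / (Module.finrank ℝ (∀ α, E α) - 1) *
        (productMetric g p a c * productMetric g p b d -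
          productMetric g p a d * productMetric g p b c) := by
  have hric : ∀ v w, ricci (productMetric g) p ![v, w] =
      (m - 1) * K * productMetric g p v w := by
    intro v w
    rw [ricci_productMetric (K := fun _ => K) hg hK, productMetric_apply, Finset.mul_sum]
    simp [hm]
  have hscal : ricciScalar (productMetric g) p =
      Module.finrank ℝ (∀ α, E α) * ((m - 1) * K) := by
    rw [ricciScalar_eq_metricTrace]
    simp only [hric, metricTrace_const_mul,
      (IsPseudoRiemannian.productMetric hg).metricTrace_self]
    ring
  have hd' : (2 : ℝ) < Module.finrank ℝ (∀ α, E α) := by exact_mod_cast hd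
  have h1 : (Module.finrank ℝ (∀ α, E α) : ℝ) - 1 ≠ 0 := by linarith
  have h2 : (Module.finrank ℝ (∀ α, E α) : ℝ) - 2 ≠ 0 := by linarith
  simp only [weyl, hric, hscal]
  rw [riemann_productMetric_of_constant (K := fun _ => K) hg hK]
  field_simp
  ring

theorem blockRiemann_single [DecidableEq ι] (K : ι → ℝ) (p : ∀ α, M α) (α : ι) (a : E α)
    (b c d : ∀ α, E α) :
    blockRiemann g K p ![Pi.single α a, b, c, d] = K α *
      (g α (p α) a (c α) * g α (p α) (b α) (d α) -
        g α (p α) a (d α) * g α (p α) (b α) (c α)) := by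
  rw [blockRiemann_apply, Finset.sum_eq_single α]
  · simp
  · intro β _ hβ
    simp [Pi.single_eq_of_ne hβ]
  · simp

/-- Since `l` lies in one block, every term of such a component contains `g(l, l)` or the product of
`l` with a transverse vector, and these vanish. -/
theorem positiveBoostWeightVanish_productMetric [DecidableEq ι] {m : ℕ}
    (hg : ∀ α, IsPseudoRiemannian (g α)) {K : ℝ}
    (hK : ∀ α (p : M α) (a b c d : E α), riemann (g α) p ![a, b, c, d] =
      K * (g α p a c * g α p b d - g α p a d * g α p b c))
    (hm : ∀ α, Module.finrank ℝ (E α) = m) (hd : 2 < Module.finrank ℝ (∀ α, E α))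
    (p : ∀ α, M α) {α : ι} {l n : E α} (hl : g α (p α) l l = 0) :
    PositiveBoostWeightVanish (productMetric g) p (Pi.single α l) (Pi.single α n) := by
  intro x y z hx hx' hy hy' hz hz'
  rw [productMetric_single] at hx hx' hy hy' hz hz'
  simp only [weyl_productMetric hg hK hm hd, blockRiemann_single, productMetric_single,
    Pi.single_eq_same, hl, hx, hx', hy, hz, (hg α).symm (p α) (x α) l]
  simp

theorem isWeylTypeD_productMetric {m : ℕ} (hg : ∀ α, IsPseudoRiemannian (g α)) {K : ℝ}
    (hK : ∀ α (p : M α) (a b c d : E α), riemann (g α) p ![a, b, c, d] =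
      K * (g α p a c * g α p b d - g α p a d * g α p b c)) (hK0 : K ≠ 0)
    (hm : ∀ α, Module.finrank ℝ (E α) = m) (hm1 : 1 < m)
    (hd : 2 < Module.finrank ℝ (∀ α, E α)) {α β : ι} (hαβ : β ≠ α)
    (hnull : ∀ p, ∃ l n, g α p l l = 0 ∧ g α p n n = 0 ∧ g α p l n = 1)
    (hβ : ∀ p, ∃ v, g β p v v ≠ 0) : IsWeylTypeD (productMetric g) := by
  classical
  intro p
  obtain ⟨l, n, hl, hn, hln⟩ := hnull (p α)
  constructor
  · obtain ⟨v, hv⟩ := hβ (p β)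
    -- For `v` in another block the block curvature drops out of `C(l, v, n, v)`, leaving a nonzero
    -- multiple of `g(l, n) g(v, v)`.
    refine ⟨Pi.single α l, Pi.single β v, Pi.single α n, Pi.single β v, ?_⟩
    have hd' : (2 : ℝ) < Module.finrank ℝ (∀ α, E α) := by exact_mod_cast hd
    have hm1' : (1 : ℝ) < m := by exact_mod_cast hm1
    rw [weyl_productMetric hg hK hm hd, blockRiemann_single]
    simp only [productMetric_single, Pi.single_eq_same, Pi.single_eq_of_ne hαβ,
      Pi.single_eq_of_ne hαβ.symm, map_zero, zero_apply, hln]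
    have h1 : (m - 1) * K / ((Module.finrank ℝ (∀ α, E α) : ℝ) - 1) ≠ 0 :=
      div_ne_zero (mul_ne_zero (by linarith) hK0) (by linarith)
    simpa using ⟨by simpa using h1, hv⟩
  · refine ⟨Pi.single α l, Pi.single α n, ?_, ?_, ?_,
      positiveBoostWeightVanish_productMetric hg hK hm hd p hl,
      positiveBoostWeightVanish_productMetric hg hK hm hd p hn⟩
    · simpa [productMetric_single] using hl
    · simpa [productMetric_single] using hn
    · simpa [productMetric_single] using hln

end Lorentzian

/-! ### Explicit Riemannian and Lorentzian factors of curvature `-1`. -/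

section Example

/-- The form `∑ i, ζ i v (i + 1) w (i + 1)`. -/
def transverseForm {m : ℕ} (ζ : Fin m → ℝ) :
    EuclideanSpace ℝ (Fin (m + 1)) →L[ℝ] EuclideanSpace ℝ (Fin (m + 1)) →L[ℝ] ℝ :=
  ∑ i, ζ i • (EuclideanSpace.proj (𝕜 := ℝ) (Fin.succ i)).smulRight
    (EuclideanSpace.proj (𝕜 := ℝ) (Fin.succ i))

theorem transverseForm_apply {m : ℕ} (ζ : Fin m → ℝ) (v w : EuclideanSpace ℝ (Fin (m + 1))) :
    transverseForm ζ v w = ∑ i : Fin m, ζ i * (v i.succ * w i.succ) := by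
  simp [transverseForm]

/-- The metric `dt² + exp (2 t) ∑ i, ζ i dx_i²`, of constant curvature `-1`. -/
def horosphericalMetric {m : ℕ} (ζ : Fin m → ℝ) :
    MetricField (EuclideanSpace ℝ (Fin (m + 1))) (EuclideanSpace ℝ (Fin (m + 1))) :=
  warpedMetric (EuclideanSpace.proj (𝕜 := ℝ) 0) (transverseForm ζ)

theorem horosphericalMetric_apply {m : ℕ} (ζ : Fin m → ℝ)
    (y v w : EuclideanSpace ℝ (Fin (m + 1))) :
    horosphericalMetric ζ y v w =
      v 0 * w 0 + Real.exp (2 * y 0) * ∑ i : Fin m, ζ i * (v i.succ * w i.succ) := by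
  rw [horosphericalMetric, warpedMetric_apply, transverseForm_apply]
  rfl

theorem transverseForm_nondegenerate {m : ℕ} {ζ : Fin m → ℝ} (hζ : ∀ i, ζ i ≠ 0)
    (v : EuclideanSpace ℝ (Fin (m + 1))) (h0 : v 0 = 0) (hv : ∀ w, transverseForm ζ v w = 0) :
    v = 0 := by
  ext i
  refine Fin.cases h0 (fun i => ?_) i
  have := hv (EuclideanSpace.single i.succ 1)
  rw [transverseForm_apply, Finset.sum_eq_single i] at this
  · simpa [hζ i] using this
  · intro j _ hj
    simp [hj]
  · simp

theorem isPseudoRiemannian_horosphericalMetric {m : ℕ} {ζ : Fin m → ℝ} (hζ : ∀ i, ζ i ≠ 0) :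
    IsPseudoRiemannian (horosphericalMetric ζ) :=
  isPseudoRiemannian_warpedMetric (e := EuclideanSpace.single 0 1) (by simp)
    (fun v w => by simp only [transverseForm_apply, mul_comm (v _)])
    (fun v => by simp [transverseForm_apply])
    (fun v h0 hv => transverseForm_nondegenerate hζ v h0 hv)

theorem riemann_horosphericalMetric {m : ℕ} {ζ : Fin m → ℝ} (hζ : ∀ i, ζ i ≠ 0)
    (p a b c d : EuclideanSpace ℝ (Fin (m + 1))) :
    riemann (horosphericalMetric ζ) p ![a, b, c, d] =
      (-1) * (horosphericalMetric ζ p a c * horosphericalMetric ζ p b d -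
        horosphericalMetric ζ p a d * horosphericalMetric ζ p b c) :=
  riemann_warpedMetric (e := EuclideanSpace.single 0 1) (by simp)
    (fun v w => by simp only [transverseForm_apply, mul_comm (v _)])
    (fun v => by simp [transverseForm_apply])
    (fun v h0 hv => transverseForm_nondegenerate hζ v h0 hv) p a b c d

theorem not_isFlat_horosphericalMetric {m : ℕ} {ζ : Fin (m + 1) → ℝ} (hζ : ∀ i, ζ i ≠ 0) :
    ¬ IsFlat (horosphericalMetric ζ) := by
  intro hflat
  have h := hflat 0 ![EuclideanSpace.single 0 1, EuclideanSpace.single (Fin.succ 0) 1,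
    EuclideanSpace.single 0 1, EuclideanSpace.single (Fin.succ 0) 1]
  rw [riemann_horosphericalMetric hζ] at h
  simp only [horosphericalMetric_apply, Fin.sum_univ_succ] at h
  simp [Fin.ext_iff, hζ] at h

theorem horosphericalMetric_pos {m : ℕ} {ζ : Fin m → ℝ} (hζ : ∀ i, 0 < ζ i)
    (p v : EuclideanSpace ℝ (Fin (m + 1))) (hv : v ≠ 0) : 0 < horosphericalMetric ζ p v v := by
  rw [horosphericalMetric_apply]
  have hs : ∀ i : Fin m, 0 ≤ ζ i * (v i.succ * v i.succ) := fun i =>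
    mul_nonneg (hζ i).le (mul_self_nonneg _)
  by_cases h0 : v 0 = 0
  · obtain ⟨i, hi⟩ : ∃ i : Fin m, v i.succ ≠ 0 := by
      by_contra! h
      exact hv (by ext i; exact Fin.cases h0 h i)
    have : 0 < ∑ i : Fin m, ζ i * (v i.succ * v i.succ) :=
      Finset.sum_pos' (fun i _ => hs i)
        ⟨i, Finset.mem_univ _, mul_pos (hζ i) (mul_self_pos.2 hi)⟩
    rw [h0, zero_mul, zero_add]
    exact mul_pos (Real.exp_pos _) this
  · exact add_pos_of_pos_of_nonneg (mul_self_pos.2 h0)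
      (mul_nonneg (Real.exp_pos _).le (Finset.sum_nonneg fun i _ => hs i))

/-- The signs of the Lorentzian horospherical metric. -/
def lorentzSign (m : ℕ) (i : Fin (m + 1)) : ℝ := if i = 0 then -1 else 1

theorem horosphericalMetric_lorentzSign_apply {m : ℕ} (p v w : EuclideanSpace ℝ (Fin (m + 2))) :
    horosphericalMetric (lorentzSign m) p v w = v 0 * w 0 + Real.exp (2 * p 0) *
      (-(v 1 * w 1) + ∑ i : Fin m, v i.succ.succ * w i.succ.succ) := by
  rw [horosphericalMetric_apply, Fin.sum_univ_succ]
  simp [lorentzSign]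

theorem isLorentzian_horosphericalMetric (m : ℕ) :
    IsLorentzian (horosphericalMetric (lorentzSign m)) := by
  intro p
  have hexp := Real.exp_pos (2 * p 0)
  refine ⟨EuclideanSpace.single 1 1, ?_, fun v hv hv0 => ?_⟩
  · rw [horosphericalMetric_lorentzSign_apply]
    simp [Fin.ext_iff, hexp]
  · rw [horosphericalMetric_lorentzSign_apply] at hv ⊢
    have h1 : v 1 = 0 := by simpa [Fin.ext_iff] using hv
    -- Where `v 1 = 0` the negative direction is absent, so the metric agrees with the positive
    -- definite one.
    have h := horosphericalMetric_pos (ζ := fun _ : Fin (m + 1) => (1 : ℝ))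
      (fun _ => one_pos) p v hv0
    rw [horosphericalMetric_apply, Fin.sum_univ_succ] at h
    simpa [h1] using h

/-- The vectors are `∂_t + exp (-t) ∂_1` and half of `∂_t - exp (-t) ∂_1`; the factor `exp (-t)`
normalizes `∂_1` to length squared `-1`. -/
theorem exists_null_horosphericalMetric (m : ℕ) (p : EuclideanSpace ℝ (Fin (m + 2))) :
    ∃ l n, horosphericalMetric (lorentzSign m) p l l = 0 ∧
      horosphericalMetric (lorentzSign m) p n n = 0 ∧
      horosphericalMetric (lorentzSign m) p l n = 1 := by
  have hexp : Real.exp (2 * p 0) * (Real.exp (-p 0) * Real.exp (-p 0)) = 1 := by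
    rw [← Real.exp_add, ← Real.exp_add]
    simp
    ring
  refine ⟨EuclideanSpace.single 0 1 + Real.exp (-p 0) • EuclideanSpace.single 1 1,
    (1 / 2 : ℝ) • EuclideanSpace.single 0 1 -
      ((1 / 2 : ℝ) * Real.exp (-p 0)) • EuclideanSpace.single 1 1, ?_, ?_, ?_⟩ <;>
  simp only [horosphericalMetric_lorentzSign_apply] <;>
  simp [Fin.ext_iff]
  · linear_combination (-1) * hexp
  · linear_combination (-1 / 4) * hexp
  · linear_combination (1 / 2) * hexp

end Example

end PseudoRiem

end

/-! ### The main theorem. -/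

theorem mainTheorem5 :
    (∀ (N : ℕ) [NeZero N] (n : Fin N → ℕ) (M : Fin N → Type*)
      [∀ α, TopologicalSpace (M α)] [∀ α, ChartedSpace (EuclideanSpace ℝ (Fin (n α))) (M α)]
      [∀ α, IsManifold (𝓡 (n α)) ∞ (M α)]
      (g : ∀ α, PseudoRiem.MetricField (EuclideanSpace ℝ (Fin (n α))) (M α)),
      (∀ α, PseudoRiem.IsPseudoRiemannian (g α)) →
      (∀ α, PseudoRiem.IsMaximallySymmetric (g α)) →
      (∀ α, ¬ PseudoRiem.IsFlat (g α)) →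
      (PseudoRiem.IsUniversal (PseudoRiem.productMetric g) ↔
        ∀ α, n α = n 0 ∧
          ∀ (x : M α) (y : M 0),
            PseudoRiem.ricciScalar (g α) x = PseudoRiem.ricciScalar (g 0) y)) ∧
    (∀ d : ℕ, 4 ≤ d → ¬ d.Prime →
      ∃ (N : ℕ) (n : Fin N → ℕ) (M : Fin N → Type)
        (_ : ∀ α, TopologicalSpace (M α))
        (_ : ∀ α, ChartedSpace (EuclideanSpace ℝ (Fin (n α))) (M α))
        (_ : ∀ α, IsManifold (𝓡 (n α)) ∞ (M α))
        (g : ∀ α, PseudoRiem.MetricField (EuclideanSpace ℝ (Fin (n α))) (M α)),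
        2 ≤ N ∧ ∑ α, n α = d ∧
        (∀ α, PseudoRiem.IsPseudoRiemannian (g α)) ∧
        (∀ α, PseudoRiem.IsMaximallySymmetric (g α)) ∧
        (∀ α, ¬ PseudoRiem.IsFlat (g α)) ∧
        T2Space (∀ α, M α) ∧ SecondCountableTopology (∀ α, M α) ∧
        ConnectedSpace (∀ α, M α) ∧
        IsManifold 𝓘(ℝ, ∀ α, EuclideanSpace ℝ (Fin (n α))) ∞ (∀ α, M α) ∧
        PseudoRiem.IsPseudoRiemannian (PseudoRiem.productMetric g) ∧
        PseudoRiem.IsLorentzian (PseudoRiem.productMetric g) ∧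
        PseudoRiem.IsUniversal (PseudoRiem.productMetric g) ∧
        PseudoRiem.IsWeylTypeD (PseudoRiem.productMetric g)) := by
  refine ⟨?_, ?_⟩
  · intro N _ n M _ _ _ g hg hsym hflat
    choose K hK using hsym
    rw [PseudoRiem.isUniversal_productMetric_iff hg hK hflat 0]
    have hnf := fun α => PseudoRiem.two_le_finrank_of_not_isFlat (hK α) (hflat α)
    simp only [finrank_euclideanSpace_fin] at hnf ⊢
    refine forall_congr' fun α => and_congr_right fun hn => ?_
    have h2 : ((2 : ℕ) : ℝ) ≤ n 0 := Nat.cast_le.2 (hnf 0).1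
    have hpos : (n 0 : ℝ) * (n 0 - 1) ≠ 0 := by
      push_cast at h2
      exact mul_ne_zero (by linarith) (by linarith)
    simp only [PseudoRiem.ricciScalar_of_constant (hg _) (hK _), finrank_euclideanSpace_fin, hn]
    constructor
    · intro h _ _
      rw [h]
    -- Points are needed to read off `K` from the Ricci scalar `n (n - 1) K`; non-flatness supplies
    -- them.
    · obtain ⟨x⟩ := (hnf α).2.2
      obtain ⟨y⟩ := (hnf 0).2.2
      exact fun h => mul_left_cancel₀ hpos (h x y)
  · intro d hd hprime
    obtain ⟨a, ⟨b, rfl⟩, ha, hab⟩ := Nat.exists_dvd_of_not_prime2 (by omega) hprime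
    obtain ⟨m, rfl⟩ : ∃ m, a = m + 2 := ⟨a - 2, by omega⟩
    obtain ⟨k, rfl⟩ : ∃ k, b = k + 2 := ⟨b - 2, by
      have : 1 < b := by
        by_contra! h
        have := Nat.mul_le_mul_left (m + 2) h
        omega
      omega⟩
    -- There are `k + 2` blocks of dimension `m + 2`; only the block `0` carries a negative sign.
    let ζ : Fin (k + 2) → Fin (m + 1) → ℝ := fun α =>
      if α = 0 then PseudoRiem.lorentzSign m else fun _ => 1
    have hζ : ∀ α i, ζ α i ≠ 0 := by
      intro α i
      by_cases h : α = 0 <;> by_cases h' : i = 0 <;> simp [ζ, PseudoRiem.lorentzSign, h, h']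
    have hζ0 : ζ 0 = PseudoRiem.lorentzSign m := rfl
    have hζpos : ∀ α, α ≠ 0 → ∀ i, 0 < ζ α i := fun α hα i => by simp [ζ, hα]
    have hg := fun α => PseudoRiem.isPseudoRiemannian_horosphericalMetric (hζ α)
    have hK := fun α => PseudoRiem.riemann_horosphericalMetric (hζ α)
    have hdim : ∀ α : Fin (k + 2),
        Module.finrank ℝ (EuclideanSpace ℝ (Fin ((fun _ => m + 2 : Fin (k + 2) → ℕ) α))) =
          m + 2 := fun _ => finrank_euclideanSpace_fin
    refine ⟨k + 2, fun _ => m + 2, fun _ => EuclideanSpace ℝ (Fin (m + 2)), inferInstance,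
      inferInstance, inferInstance, fun α => PseudoRiem.horosphericalMetric (ζ α), by omega,
      by simp [mul_comm], hg, fun α => ⟨-1, hK α⟩,
      fun α => PseudoRiem.not_isFlat_horosphericalMetric (hζ α), inferInstance, inferInstance,
      inferInstance, PseudoRiem.isManifold_pi, PseudoRiem.IsPseudoRiemannian.productMetric hg,
      PseudoRiem.isLorentzian_productMetric (α := 0)
        (by rw [hζ0]; exact PseudoRiem.isLorentzian_horosphericalMetric m)
        (fun α hα p v hv => PseudoRiem.horosphericalMetric_pos (hζpos α hα) p v hv),
      PseudoRiem.isUniversal_productMetric hg hK hdim,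
      PseudoRiem.isWeylTypeD_productMetric hg hK (by norm_num) hdim (by omega) ?_
        (α := 0) (β := 1) (by simp)
        (by rw [hζ0]; exact PseudoRiem.exists_null_horosphericalMetric m)
        (fun p => ⟨EuclideanSpace.single 0 1, ne_of_gt
          (PseudoRiem.horosphericalMetric_pos (hζpos 1 (by simp)) p _ (by simp))⟩)⟩
    rw [Module.finrank_pi_fintype]
    simp only [finrank_euclideanSpace_fin, Finset.sum_const, Finset.card_univ, Fintype.card_fin,
      smul_eq_mul]
    nlinarith
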